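/- **Setting.** Let $b>0$ (block reward), $\tau_0>0$ (mean interblock time), $0<q<1/2$, $p=1-q$, and let $z\ge 1$ and $A\ge \max(2,z)$ be integers. The honest miners and an attacker find blocks along two independent Poisson processes of rates $p/\tau_0$ and $q/\tau_0$. One attack cycle of the *$A$-Nakamoto double spend* of an amount $v\ge 0$ with $z$ confirmations runs as follows. The attacker mines on top of the official blockchain until he finds a block (time $\sigma$), which he keeps secret and extends to a secret fork. At a time $t\ge\sigma$ let $M(t)$ be the length of the secret fork (including the first secret block) and $H(t)$ the number of blocks that the honest miners have found since $\sigma$. The cycle ends at the first time $T_A\ge\sigma$ at which either $H\ge z$ and $M>H$ (success), or $H-M\ge A$ (the attacker gives up). The revenue $R_A$ of the cycle is $v+b\,M(T_A)$ in case of success and $0$ otherwise. The cycle ends almost surely and $R_A$, $T_A$ are integrable, with $\mathbb E[T_A]>0$; put $\Gamma_A=\mathbb E[R_A]/\mathbb E[T_A]$. The strategy is profitable if $\Gamma_A\ge\Gamma_H$, where $\Gamma_H=qb/\tau_0$ is the revenue ratio of honest mining. There is a least $v\ge 0$ with $\Gamma_A\ge\Gamma_H$; it is denoted $v_{\min}(q,A)$.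 **Statement.** Fix $b,\tau_0,z$ and put $$L_v(q)=\frac{b}{\tau_0}\left[2\binom{2z-1}{z}\left(\frac vb+1\right)+\frac{2}{B(z,z)}\right]q^{z+1},\qquad v_0(q)=\frac{q^{-z}\,b}{2\binom{2z-1}{z}},$$ where $B$ is the Beta function. 1. For every fixed $v\ge0$ and every $A\ge\max(2,z)$, $\Gamma_A\sim L_v(q)$ as $q\to0^+$; the equivalent does not depend on $A$. Moreover, for every $v\ge 0$ and $\varepsilon>0$ there is $\delta\in(0,1/2)$ such that, for all $0<q\le\delta$ and all $A\ge\max(2,z)$, we have $\Gamma_A\le(1+\varepsilon)L_v(q)$, and also $\Gamma_A\ge(1-\varepsilon)L_v(q)$ if $qA\le\delta$. 2. For every fixed $A\ge\max(2,z)$, the minimal profitable amount satisfies $v_{\min}(q,A)\sim v_0(q)$ as $q\to0^+$. Moreover, for every $\varepsilon>0$ there is $\delta\in(0,1/2)$ such that, for all $0<q\le\delta$, all $A\ge\max(2,z)$ and all $v\ge0$: if $\Gamma_A\ge\Gamma_H$ then $v\ge(1-\varepsilon)v_0(q)$; and if $qA\le\delta$ and $v\ge(1+\varepsilon)v_0(q)$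 then $\Gamma_A>\Gamma_H$. -/

import Mathlib

open MeasureTheory ProbabilityTheory Filter Topology Asymptotics

noncomputable section

namespace DoubleSpend

/-- A realization of the mining process during one attack cycle. `ω.1 k` is the `k`-th waiting time
between blocks of the honest miners, `ω.2 k` the `k`-th waiting time between blocks of the
attacker, with `k = 0, 1, 2, …` and time counted from the start of the cycle. -/
abbrev Path : Type := (ℕ → ℝ) × (ℕ → ℝ)

/-- The law of the mining process: the honest miners and the attacker find blocks along two
independent Poisson processes of rates `(1 - q) / τ₀` and `q / τ₀`, i.e. all waiting times are
independent and exponential with these rates. -/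
def law (q τ₀ : ℝ) : Measure Path :=
  (Measure.infinitePi fun _ : ℕ => expMeasure ((1 - q) / τ₀)).prod
    (Measure.infinitePi fun _ : ℕ => expMeasure (q / τ₀))

/-- The counting process of a sequence of waiting times `x 0, x 1, …`: the number of `n ≥ 1` such
that the `n`-th block, found at time `x 0 + ⋯ + x (n - 1)`, is found no later than `t`. -/
def blockCount (x : ℕ → ℝ) (t : ℝ) : ℕ :=
  Set.ncard {n : ℕ | 1 ≤ n ∧ ∑ k ∈ Finset.range n, x k ≤ t}

/-- The time at which the attacker finds his first block of the cycle, which he keeps secret (the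
pre-mined block). Until then he mines on top of the official blockchain and restarts whenever the
honest miners extend it, so that the secret fork starts with this block. -/
def preMineTime (ω : Path) : ℝ := ω.2 0

/-- Length of the secret fork at a time `t ≥ preMineTime ω`, the pre-mined block included. -/
def secretBlocks (ω : Path) (t : ℝ) : ℕ := blockCount ω.2 t

/-- Number of blocks added to the official blockchain between the pre-mining of the secret block
(when the transaction is sent to the vendor) and a time `t ≥ preMineTime ω`. -/
def officialBlocks (ω : Path) (t : ℝ) : ℕ :=
  blockCount ω.1 t - blockCount ω.1 (preMineTime ω)

/-- The double spend succeeds: the vendor's transaction has `z` confirmations and the secret fork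
is longer than the official blockchain. -/
def Succeeds (z : ℕ) (ω : Path) (t : ℝ) : Prop :=
  z ≤ officialBlocks ω t ∧ officialBlocks ω t < secretBlocks ω t

/-- The attacker gives up: his lag behind the official blockchain has reached `A`. -/
def GivesUp (A : ℕ) (ω : Path) (t : ℝ) : Prop :=
  secretBlocks ω t + A ≤ officialBlocks ω t

/-- The times, after the pre-mining phase, at which a reason to end the attack cycle is present. -/
def endTimes (z A : ℕ) (ω : Path) : Set ℝ :=
  {t | preMineTime ω ≤ t ∧ (Succeeds z ω t ∨ GivesUp A ω t)}

/-- The duration `T_A` of the attack cycle of the `A`-Nakamoto double spend. -/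
def duration (z A : ℕ) (ω : Path) : ℝ := sInf (endTimes z A ω)

open scoped Classical in
/-- The revenue `R_A` of the attack cycle: if the double spend succeeds, its amount `v` and the
reward `b` of every block of the secret fork; otherwise nothing. -/
def revenue (b v : ℝ) (z A : ℕ) (ω : Path) : ℝ :=
  if Succeeds z ω (duration z A ω) then v + b * (secretBlocks ω (duration z A ω) : ℝ) else 0

/-- The revenue ratio `Γ_A = E[R_A] / E[T_A]`. -/
def revenueRatio (τ₀ b v : ℝ) (z A : ℕ) (q : ℝ) : ℝ :=
  (∫ ω, revenue b v z A ω ∂(law q τ₀)) / ∫ ω, duration z A ω ∂(law q τ₀)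

/-- The revenue ratio `Γ_H = q b / τ₀` of honest mining. -/
def honestRatio (τ₀ b q : ℝ) : ℝ := q * b / τ₀

/-- The leading term `(b / τ₀) (2 C(2z-1,z) (v/b + 1) + 2 / B(z,z)) q ^ (z+1)` of `Γ_A`. -/
def leadingTerm (τ₀ b v : ℝ) (z : ℕ) (q : ℝ) : ℝ :=
  b / τ₀ * (2 * ((2 * z - 1).choose z : ℝ) * (v / b + 1) + 2 / beta z z) * q ^ (z + 1)

/-- The amounts `v ≥ 0` for which the `A`-Nakamoto double spend is profitable. -/
def profitableAmounts (τ₀ b : ℝ) (z A : ℕ) (q : ℝ) : Set ℝ :=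
  {v | 0 ≤ v ∧ honestRatio τ₀ b q ≤ revenueRatio τ₀ b v z A q}

/-- The minimal amount that makes the `A`-Nakamoto double spend profitable. -/
def minimalAmount (τ₀ b : ℝ) (z A : ℕ) (q : ℝ) : ℝ := sInf (profitableAmounts τ₀ b z A q)

/-- The threshold `v₀ = q ^ (-z) b / (2 C(2z-1,z))`. -/
def threshold (b : ℝ) (z : ℕ) (q : ℝ) : ℝ :=
  (q ^ z)⁻¹ / (2 * ((2 * z - 1).choose z : ℝ)) * b

end DoubleSpend

end

/-! By memorylessness, the miners of successive blocks are independent, the attacker being chosen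
with probability `q`, and the waiting times left after each block are independent of the past with
the original law (`lintegral_bit_residual`). The same holds after the pre-mined block
(`measurePreserving_afterPreMine`). A cycle is thus a pre-mining wait of mean `τ₀ / q`, followed by
a stopped Bernoulli walk.

Denominator: while the attack runs, the honest blocks exceed the attacker's by at most `A`.
Comparing expected counts, as in Wald's identity, bounds the mean number of blocks by `(A + 1) / (1
- 2 * q)`. Hence `E[T]` lies between `τ₀ / q` and `(τ₀ / q) * (1 + 3 * q * A)` for small `q`; only
the upper estimate involves `A`.

Numerator: success needs at least `2 * z` blocks after pre-mining, at least half of them the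
attacker's. Success at exactly `2 * z` blocks has probability `C(2z,z) * (q * (1 - q)) ^ z` and pays
`v + b * (z + 1)`. For longer attacks, a Chernoff bound `(2 * √q) ^ n` for `n` blocks sums to a
contribution smaller by a factor of order `√q`, for every `A`.

The quotient is `C(2z,z) * (v + b * (z + 1)) * q ^ z * (q / τ₀)`, which is `leadingTerm` because `1
/ B(z,z) = z * C(2z-1,z)`. The relative errors do not depend on `v`, so they may be used at `v` of
order `q ^ (-z)`. There `b * (z + 1)` is negligible, and comparison with `q * b / τ₀` gives the
threshold. -/

noncomputable section

namespace DoubleSpend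

open scoped ENNReal

/-! ### Exponential laws and memorylessness -/

lemma expMeasure_eq_withDensity (r : ℝ) :
    expMeasure r = volume.withDensity (exponentialPDF r) := rfl

lemma measurable_exponentialPDF (r : ℝ) : Measurable (exponentialPDF r) :=
  (measurable_exponentialPDFReal r).ennreal_ofReal

lemma lintegral_expMeasure (r : ℝ) {f : ℝ → ℝ≥0∞} (hf : Measurable f) :
    ∫⁻ x, f x ∂expMeasure r = ∫⁻ x, exponentialPDF r x * f x := by
  rw [expMeasure_eq_withDensity, lintegral_withDensity_eq_lintegral_mul _
    (measurable_exponentialPDF r) hf]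
  rfl

lemma expMeasure_singleton (r x : ℝ) : expMeasure r {x} = 0 :=
  withDensity_absolutelyContinuous _ _ (by simp)

lemma ae_pos_expMeasure (r : ℝ) : ∀ᵐ x ∂expMeasure r, 0 < x := by
  have h : expMeasure r (Set.Iio 0) = 0 := by
    rw [expMeasure_eq_withDensity, withDensity_apply _ measurableSet_Iio]
    exact lintegral_exponentialPDF_of_nonpos le_rfl
  have h' : expMeasure r (Set.Iic 0) = 0 := by
    rw [← Set.Iio_union_right]
    exact measure_union_null h (expMeasure_singleton r 0)
  rw [ae_iff]
  simpa [Set.Iic] using h'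

/-- The exponential law is memoryless. -/
lemma lintegral_expMeasure_shift {r s : ℝ} (hs : 0 ≤ s) {f : ℝ → ℝ≥0∞}
    (hf : Measurable f) :
    ∫⁻ y, (if s ≤ y then f (y - s) else 0) ∂expMeasure r
      = ENNReal.ofReal (Real.exp (-(r * s))) * ∫⁻ y, f y ∂expMeasure r := by
  have hm : Measurable fun y => if s ≤ y then f (y - s) else 0 :=
    Measurable.ite measurableSet_Ici (by fun_prop) measurable_const
  rw [lintegral_expMeasure r hm, lintegral_expMeasure r hf,
    ← lintegral_add_right_eq_self _ s, ← lintegral_const_mul' _ _ ENNReal.ofReal_ne_top]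
  refine lintegral_congr fun y => ?_
  simp only [le_add_iff_nonneg_left, add_sub_cancel_right]
  by_cases hy : 0 ≤ y
  · rw [if_pos hy, exponentialPDF_of_nonneg hy, exponentialPDF_of_nonneg (by positivity),
      ← mul_assoc, ← ENNReal.ofReal_mul (Real.exp_pos _).le]
    congr 2
    rw [mul_left_comm, ← Real.exp_add]
    ring_nf
  · rw [if_neg hy, exponentialPDF_of_neg (not_le.1 hy)]
    simp

/-- Points are null. The strict form serves the case of an honest next block, since `bit` assigns
ties to the attacker. -/
lemma lintegral_expMeasure_shift' {r s : ℝ} (hs : 0 ≤ s) {f : ℝ → ℝ≥0∞}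
    (hf : Measurable f) :
    ∫⁻ y, (if s < y then f (y - s) else 0) ∂expMeasure r
      = ENNReal.ofReal (Real.exp (-(r * s))) * ∫⁻ y, f y ∂expMeasure r := by
  rw [← lintegral_expMeasure_shift hs hf]
  have : ∀ᵐ y ∂expMeasure r, y ≠ s := by
    rw [ae_iff]; simpa using expMeasure_singleton r s
  refine lintegral_congr_ae (this.mono fun y hy => ?_)
  simp [lt_iff_le_and_ne, hy.symm]

/-- On the support the integrand against Lebesgue measure is `α / (α + β)` times the exponential
density of rate `α + β`. -/
lemma lintegral_exp_neg_expMeasure {α β : ℝ} (hα : 0 < α) (hβ : 0 < β) :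
    ∫⁻ x, ENNReal.ofReal (Real.exp (-(β * x))) ∂expMeasure α
      = ENNReal.ofReal (α / (α + β)) := by
  rw [lintegral_expMeasure _ (by fun_prop), ← mul_one (ENNReal.ofReal (α / (α + β))),
    ← lintegral_exponentialPDF_eq_one (add_pos hα hβ),
    ← lintegral_const_mul' _ _ ENNReal.ofReal_ne_top]
  refine lintegral_congr fun x => ?_
  by_cases hx : 0 ≤ x
  · rw [exponentialPDF_of_nonneg hx, exponentialPDF_of_nonneg hx,
      ← ENNReal.ofReal_mul (by positivity), ← ENNReal.ofReal_mul (by positivity)]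
    congr 1
    rw [mul_assoc, ← Real.exp_add]
    have : α + β ≠ 0 := by positivity
    field_simp
    ring_nf
  · simp [exponentialPDF_of_neg (not_le.1 hx)]

lemma lintegral_id_expMeasure {r : ℝ} (hr : 0 < r) :
    ∫⁻ x, ENNReal.ofReal x ∂expMeasure r = ENNReal.ofReal (1 / r) := by
  -- `x` times the exponential density is `1 / r` times the Gamma density of shape 2, which has mass
  -- one.
  rw [lintegral_expMeasure _ (by fun_prop), ← mul_one (ENNReal.ofReal (1 / r)),
    ← lintegral_gammaPDF_eq_one (a := 2) two_pos hr,
    ← lintegral_const_mul' _ _ ENNReal.ofReal_ne_top]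
  refine lintegral_congr fun x => ?_
  by_cases hx : 0 ≤ x
  · rw [exponentialPDF_of_nonneg hx, gammaPDF_of_nonneg hx,
      ← ENNReal.ofReal_mul (by positivity), ← ENNReal.ofReal_mul (by positivity)]
    congr 1
    have h1 : (2 : ℝ) - 1 = 1 := by norm_num
    rw [Real.Gamma_two, h1, Real.rpow_one, Real.rpow_two]
    field_simp
  · rw [exponentialPDF_of_neg (not_le.1 hx), gammaPDF_of_neg (not_le.1 hx)]
    simp

/-! ### Splitting off the first waiting time -/

/-- The sequence `a, x 0, x 1, …`. -/
def seqCons (a : ℝ) (x : ℕ → ℝ) : ℕ → ℝ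
  | 0 => a
  | n + 1 => x n

@[simp] lemma seqCons_zero (a : ℝ) (x : ℕ → ℝ) : seqCons a x 0 = a := rfl
@[simp] lemma seqCons_succ (a : ℝ) (x : ℕ → ℝ) (n : ℕ) : seqCons a x (n + 1) = x n := rfl

/-- The sequence `x 1, x 2, …`. -/
def seqTail (x : ℕ → ℝ) : ℕ → ℝ := fun n => x (n + 1)

@[simp] lemma seqTail_apply (x : ℕ → ℝ) (n : ℕ) : seqTail x n = x (n + 1) := rfl
@[simp] lemma seqTail_seqCons (a : ℝ) (x : ℕ → ℝ) : seqTail (seqCons a x) = x := rfl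

@[fun_prop]
lemma measurable_seqTail : Measurable seqTail :=
  measurable_pi_lambda _ fun n => measurable_pi_apply (n + 1)

@[fun_prop]
lemma Measurable.seqCons {Ω : Type*} [MeasurableSpace Ω] {a : Ω → ℝ} {x : Ω → ℕ → ℝ}
    (ha : Measurable a) (hx : Measurable x) :
    Measurable fun ω => seqCons (a ω) (x ω) := by
  refine measurable_pi_lambda _ fun n => ?_
  cases n with
  | zero => exact ha
  | succ n => exact (measurable_pi_apply n).comp hx

/-- Finite boxes determine a product measure, and the preimage of a box is a box: a condition on the
head times a shifted condition on the tail. -/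
lemma map_seqCons_infinitePi (ν : Measure ℝ) [IsProbabilityMeasure ν] :
    (ν.prod (Measure.infinitePi fun _ : ℕ => ν)).map (fun p => seqCons p.1 p.2)
      = Measure.infinitePi fun _ : ℕ => ν := by
  refine Measure.eq_infinitePi _ fun s t ht => ?_
  rw [Measure.map_apply (by fun_prop) (.pi s.countable_toSet fun i _ => ht i)]
  have hinj : Set.InjOn Nat.succ (Nat.succ ⁻¹' (s : Set ℕ)) := Nat.succ_injective.injOn
  have key : (fun p : ℝ × (ℕ → ℝ) => seqCons p.1 p.2) ⁻¹' ((s : Set ℕ).pi t)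
      = (if 0 ∈ s then t 0 else Set.univ) ×ˢ
        (((s.preimage Nat.succ hinj : Finset ℕ) : Set ℕ).pi fun i => t (i + 1)) := by
    ext ⟨a, x⟩
    simp only [Set.mem_preimage, Set.mem_pi, Finset.mem_coe, Set.mem_prod, Finset.mem_preimage,
      Nat.succ_eq_add_one]
    constructor
    · intro h
      refine ⟨?_, fun i hi => h (i + 1) hi⟩
      split_ifs with h0
      · exact h 0 h0
      · trivial
    · rintro ⟨h0, h⟩ (_ | i) hi
      · simpa [hi] using h0
      · exact h i hi
  rw [key, Measure.prod_prod, Measure.infinitePi_pi _ (fun i _ => ht _)]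
  have himg : (s.preimage Nat.succ hinj).image Nat.succ = s.erase 0 := by
    ext i
    cases i <;> simp
  have hprod : ∏ i ∈ s.preimage Nat.succ hinj, ν (t (i + 1)) = ∏ i ∈ s.erase 0, ν (t i) := by
    rw [← himg, Finset.prod_image (fun _ _ _ _ h => Nat.succ_injective h)]
  rw [hprod]
  split_ifs with h0
  · exact Finset.mul_prod_erase s (fun i => ν (t i)) h0
  · rw [measure_univ, one_mul, Finset.erase_eq_of_notMem h0]

lemma lintegral_infinitePi_seqCons (ν : Measure ℝ) [IsProbabilityMeasure ν]
    {f : (ℕ → ℝ) → ℝ≥0∞} (hf : Measurable f) :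
    ∫⁻ x, f x ∂(Measure.infinitePi fun _ : ℕ => ν)
      = ∫⁻ a, ∫⁻ x, f (seqCons a x) ∂(Measure.infinitePi fun _ : ℕ => ν) ∂ν := by
  conv_lhs => rw [← map_seqCons_infinitePi ν]
  rw [lintegral_map hf (by fun_prop), lintegral_prod _ (by fun_prop)]

section Law

variable {q τ₀ : ℝ}

lemma lintegral_law_seqCons_snd (hτ : 0 < τ₀) (hq : 0 < q) (hq1 : q < 1) {f : Path → ℝ≥0∞}
    (hf : Measurable f) :
    ∫⁻ ω, f ω ∂law q τ₀ =
      ∫⁻ b, ∫⁻ ω, f (ω.1, seqCons b ω.2) ∂law q τ₀ ∂expMeasure (q / τ₀) := by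
  have := isProbabilityMeasure_expMeasure (r := (1 - q) / τ₀) (div_pos (by linarith) hτ)
  have := isProbabilityMeasure_expMeasure (r := q / τ₀) (div_pos hq hτ)
  unfold law
  rw [lintegral_prod _ hf.aemeasurable]
  have h1 : ∀ x : ℕ → ℝ, ∫⁻ y, f (x, y) ∂(Measure.infinitePi fun _ : ℕ => expMeasure (q / τ₀))
      = ∫⁻ b, ∫⁻ y, f (x, seqCons b y) ∂(Measure.infinitePi fun _ : ℕ => expMeasure (q / τ₀))
        ∂expMeasure (q / τ₀) :=
    fun x => lintegral_infinitePi_seqCons _ (by fun_prop)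
  simp_rw [h1]
  rw [lintegral_lintegral_swap]
  · refine lintegral_congr fun b => ?_
    rw [lintegral_prod _ (by fun_prop)]
  · refine Measurable.aemeasurable ?_
    exact Measurable.lintegral_prod_right'
      (f := fun p : ((ℕ → ℝ) × ℝ) × (ℕ → ℝ) => f (p.1.1, seqCons p.1.2 p.2)) (by fun_prop)

lemma lintegral_law_seqCons_fst (hτ : 0 < τ₀) (hq : 0 < q) (hq1 : q < 1) {f : Path → ℝ≥0∞}
    (hf : Measurable f) :
    ∫⁻ ω, f ω ∂law q τ₀ =
      ∫⁻ a, ∫⁻ ω, f (seqCons a ω.1, ω.2) ∂law q τ₀ ∂expMeasure ((1 - q) / τ₀) := by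
  have := isProbabilityMeasure_expMeasure (r := (1 - q) / τ₀) (div_pos (by linarith) hτ)
  have := isProbabilityMeasure_expMeasure (r := q / τ₀) (div_pos hq hτ)
  unfold law
  rw [lintegral_prod _ hf.aemeasurable, lintegral_infinitePi_seqCons _
    (Measurable.lintegral_prod_right' hf)]
  refine lintegral_congr fun a => ?_
  rw [lintegral_prod _ (by fun_prop)]

lemma isProbabilityMeasure_law (hτ : 0 < τ₀) (hq : 0 < q) (hq1 : q < 1) :
    IsProbabilityMeasure (law q τ₀) := by
  have := isProbabilityMeasure_expMeasure (r := (1 - q) / τ₀) (div_pos (by linarith) hτ)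
  have := isProbabilityMeasure_expMeasure (r := q / τ₀) (div_pos hq hτ)
  unfold law
  infer_instance

end Law

/-! ### The next block and the renewal after it -/

/-- Whether the next block is found by the attacker. -/
def bit (ω : Path) : Bool := decide (ω.2 0 ≤ ω.1 0)

/-- The waiting time until the next block. -/
def wait (ω : Path) : ℝ := min (ω.1 0) (ω.2 0)

/-- The waiting times that remain after the next block has been found. -/
def residual (ω : Path) : Path :=
  if ω.2 0 ≤ ω.1 0 then (seqCons (ω.1 0 - ω.2 0) (seqTail ω.1), seqTail ω.2)
  else (seqTail ω.1, seqCons (ω.2 0 - ω.1 0) (seqTail ω.2))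

lemma measurableSet_attacker_next : MeasurableSet {ω : Path | ω.2 0 ≤ ω.1 0} :=
  measurableSet_le (by fun_prop) (by fun_prop)

@[fun_prop]
lemma measurable_residual : Measurable residual :=
  Measurable.ite measurableSet_attacker_next (by fun_prop) (by fun_prop)

@[fun_prop]
lemma measurable_bit : Measurable bit := by
  refine measurable_to_bool ?_
  convert! measurableSet_attacker_next using 1
  ext ω; simp [bit]

@[fun_prop]
lemma measurable_wait : Measurable wait := by unfold wait; fun_prop

/-- The probability that a block is found by the attacker (`true`) or by the honest miners. -/
def prob (q : ℝ) (c : Bool) : ℝ≥0∞ := ENNReal.ofReal (if c then q else 1 - q)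

section Law

variable {q τ₀ : ℝ}

/-- Given the first honest wait `a`, the attacker's wait exceeds `a` with probability `exp (-q * a /
τ₀)`, and its excess is again exponential. Averaging over `a` gives `1 - q`. -/
lemma lintegral_honest_next (hτ : 0 < τ₀) (hq : 0 < q) (hq1 : q < 1) {g : Path → ℝ≥0∞}
    (hg : Measurable g) :
    ∫⁻ ω, (if ω.2 0 ≤ ω.1 0 then 0 else g (residual ω)) ∂law q τ₀
      = ENNReal.ofReal (1 - q) * ∫⁻ ω, g ω ∂law q τ₀ := by
  have := isProbabilityMeasure_law hτ hq hq1
  have hm : Measurable fun ω : Path => if ω.2 0 ≤ ω.1 0 then 0 else g (residual ω) :=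
    Measurable.ite measurableSet_attacker_next measurable_const (by fun_prop)
  rw [lintegral_law_seqCons_fst hτ hq hq1 hm]
  have h1 : ∀ a : ℝ, 0 < a → ∫⁻ ω : Path, (if ω.2 0 ≤ seqCons a ω.1 0 then 0
      else g (residual (seqCons a ω.1, ω.2))) ∂law q τ₀
      = ENNReal.ofReal (Real.exp (-(q / τ₀ * a))) * ∫⁻ ω, g ω ∂law q τ₀ := by
    intro a ha
    have hm' : Measurable fun ω : Path => if ω.2 0 ≤ seqCons a ω.1 0 then 0
        else g (residual (seqCons a ω.1, ω.2)) :=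
      hm.comp (g := fun ω : Path => if ω.2 0 ≤ ω.1 0 then 0 else g (residual ω))
        (f := fun ω : Path => (seqCons a ω.1, ω.2)) (by fun_prop)
    rw [lintegral_law_seqCons_snd hτ hq hq1 hm',
      lintegral_law_seqCons_snd hτ hq hq1 hg,
      ← lintegral_expMeasure_shift' ha.le (Measurable.lintegral_prod_right'
        (f := fun p : ℝ × Path => g (p.2.1, seqCons p.1 p.2.2)) (by fun_prop))]
    refine lintegral_congr fun y => ?_
    by_cases h : y ≤ a
    · simp [h, not_lt.2 h]
    · simp [h, not_le.1 h, residual]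
  rw [lintegral_congr_ae ((ae_pos_expMeasure _).mono h1), lintegral_mul_const _ (by fun_prop),
    lintegral_exp_neg_expMeasure (div_pos (by linarith) hτ) (div_pos hq hτ)]
  congr 2
  field_simp
  ring

lemma lintegral_attacker_next (hτ : 0 < τ₀) (hq : 0 < q) (hq1 : q < 1) {g : Path → ℝ≥0∞}
    (hg : Measurable g) :
    ∫⁻ ω, (if ω.2 0 ≤ ω.1 0 then g (residual ω) else 0) ∂law q τ₀
      = ENNReal.ofReal q * ∫⁻ ω, g ω ∂law q τ₀ := by
  have := isProbabilityMeasure_law hτ hq hq1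
  have hm : Measurable fun ω : Path => if ω.2 0 ≤ ω.1 0 then g (residual ω) else 0 :=
    Measurable.ite measurableSet_attacker_next (by fun_prop) measurable_const
  rw [lintegral_law_seqCons_snd hτ hq hq1 hm]
  have h1 : ∀ a : ℝ, 0 < a → ∫⁻ ω : Path, (if seqCons a ω.2 0 ≤ ω.1 0 then
      g (residual (ω.1, seqCons a ω.2)) else 0) ∂law q τ₀
      = ENNReal.ofReal (Real.exp (-((1 - q) / τ₀ * a))) * ∫⁻ ω, g ω ∂law q τ₀ := by
    intro a ha
    have hm' : Measurable fun ω : Path => if seqCons a ω.2 0 ≤ ω.1 0 then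
        g (residual (ω.1, seqCons a ω.2)) else 0 :=
      hm.comp (g := fun ω : Path => if ω.2 0 ≤ ω.1 0 then g (residual ω) else 0)
        (f := fun ω : Path => (ω.1, seqCons a ω.2)) (by fun_prop)
    rw [lintegral_law_seqCons_fst hτ hq hq1 hm',
      lintegral_law_seqCons_fst hτ hq hq1 hg,
      ← lintegral_expMeasure_shift ha.le (Measurable.lintegral_prod_right'
        (f := fun p : ℝ × Path => g (seqCons p.1 p.2.1, p.2.2)) (by fun_prop))]
    refine lintegral_congr fun y => ?_
    by_cases h : a ≤ y
    · simp [h, residual]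
    · simp [h]
  rw [lintegral_congr_ae ((ae_pos_expMeasure _).mono h1), lintegral_mul_const _ (by fun_prop),
    lintegral_exp_neg_expMeasure (div_pos hq hτ) (div_pos (by linarith) hτ)]
  congr 2
  field_simp
  ring

/-- The next miner and the remaining waiting times are independent, and the latter are distributed
as the original ones. -/
lemma lintegral_bit_residual (hτ : 0 < τ₀) (hq : 0 < q) (hq1 : q < 1) {g : Bool → Path → ℝ≥0∞}
    (hg : ∀ c, Measurable (g c)) :
    ∫⁻ ω, g (bit ω) (residual ω) ∂law q τ₀
      = prob q false * ∫⁻ ω, g false ω ∂law q τ₀ + prob q true * ∫⁻ ω, g true ω ∂law q τ₀ := by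
  have hm : Measurable fun ω : Path => if ω.2 0 ≤ ω.1 0 then 0 else g false (residual ω) :=
    Measurable.ite measurableSet_attacker_next measurable_const
      ((hg false).comp measurable_residual)
  simp only [prob, if_true, Bool.false_eq_true, if_false]
  rw [← lintegral_honest_next hτ hq hq1 (hg false), ← lintegral_attacker_next hτ hq hq1 (hg true),
    ← lintegral_add_left hm]
  refine lintegral_congr fun ω => ?_
  by_cases h : ω.2 0 ≤ ω.1 0 <;> simp [bit, h]

end Law

/-! ### The sequence of miners as Bernoulli trials -/

/-- The miners of the first `n` blocks. -/
def bits : ℕ → Path → List Bool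
  | 0, _ => []
  | n + 1, ω => bit ω :: bits n (residual ω)

@[simp] lemma bits_zero (ω : Path) : bits 0 ω = [] := rfl
lemma bits_succ (n : ℕ) (ω : Path) : bits (n + 1) ω = bit ω :: bits n (residual ω) := rfl

@[simp] lemma length_bits (n : ℕ) (ω : Path) : (bits n ω).length = n := by
  induction n generalizing ω with
  | zero => rfl
  | succ n ih => simp [bits_succ, ih]

lemma bits_add (m n : ℕ) (ω : Path) :
    bits (m + n) ω = bits m ω ++ bits n (residual^[m] ω) := by
  induction m generalizing ω with
  | zero => simp
  | succ m ih => rw [Nat.succ_add, bits_succ, ih, bits_succ, Function.iterate_succ_apply]; rfl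

lemma bits_succ' (n : ℕ) (ω : Path) :
    bits (n + 1) ω = bits n ω ++ [bit (residual^[n] ω)] := by
  rw [bits_add]; rfl

lemma take_bits {k n : ℕ} (h : k ≤ n) (ω : Path) : (bits n ω).take k = bits k ω := by
  obtain ⟨m, rfl⟩ := Nat.exists_eq_add_of_le h
  rw [bits_add, List.take_left' (length_bits k ω)]

lemma measurable_comp_bits {β : Type*} [MeasurableSpace β] (F : List Bool → β) (n : ℕ) :
    Measurable fun ω => F (bits n ω) := by
  induction n generalizing F with
  | zero => simp only [bits_zero, measurable_const]
  | succ n ih =>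
    have h : (fun ω => F (bits (n + 1) ω)) = fun ω =>
        if bit ω = true then F (true :: bits n (residual ω))
        else F (false :: bits n (residual ω)) := by
      ext ω
      cases h : bit ω <;> simp [bits_succ, h]
    rw [h]
    exact Measurable.ite (measurable_bit (measurableSet_singleton true))
      ((ih fun l => F (true :: l)).comp measurable_residual)
      ((ih fun l => F (false :: l)).comp measurable_residual)

lemma measurableSet_bits (P : List Bool → Prop) (n : ℕ) : MeasurableSet {ω | P (bits n ω)} := by
  have := measurable_comp_bits P n
  exact measurableSet_setOfPred.2 this

@[fun_prop]
lemma measurable_iterate_residual (n : ℕ) : Measurable (residual^[n]) :=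
  measurable_residual.iterate n

/-- The expectation of a function of `n` independent miners. -/
def expect (q : ℝ) : ℕ → (List Bool → ℝ≥0∞) → ℝ≥0∞
  | 0, F => F []
  | n + 1, F => prob q false * expect q n (fun l => F (false :: l))
      + prob q true * expect q n (fun l => F (true :: l))

lemma prob_add {q : ℝ} (hq : 0 < q) (hq1 : q < 1) : prob q false + prob q true = 1 := by
  simp only [prob, Bool.false_eq_true, if_true, if_false]
  rw [← ENNReal.ofReal_add (by linarith) hq.le]
  simp

lemma expect_mono (q : ℝ) {n : ℕ} {F G : List Bool → ℝ≥0∞}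
    (h : ∀ l, l.length = n → F l ≤ G l) : expect q n F ≤ expect q n G := by
  induction n generalizing F G with
  | zero => exact h [] rfl
  | succ n ih =>
    simp only [expect]
    gcongr
    · exact ih fun l hl => h _ (by simp [hl])
    · exact ih fun l hl => h _ (by simp [hl])

lemma expect_const_mul (q : ℝ) (n : ℕ) (c : ℝ≥0∞) (F : List Bool → ℝ≥0∞) :
    expect q n (fun l => c * F l) = c * expect q n F := by
  induction n generalizing F with
  | zero => rfl
  | succ n ih => simp only [expect, ih]; ring

lemma expect_zero (q : ℝ) (n : ℕ) : expect q n (fun _ => 0) = 0 := by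
  simpa using expect_const_mul q n 0 0

/-- The binomial generating function: `c = 1` gives the total mass, `c = q⁻¹` the exponential moment
of the Chernoff bound. -/
lemma expect_pow_count (q : ℝ) (n : ℕ) (c : ℝ≥0∞) :
    expect q n (fun l => c ^ l.count true) = (prob q false + prob q true * c) ^ n := by
  induction n with
  | zero => simp [expect]
  | succ n ih =>
    have h : expect q n (fun l => c ^ (l.count true + 1))
        = c * (prob q false + prob q true * c) ^ n := by
      rw [← ih, ← expect_const_mul]
      simp only [pow_succ']
    simp only [expect, List.count_cons, beq_self_eq_true, if_true, beq_iff_eq,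
      Bool.false_eq_true, if_false, add_zero, ih, h]
    ring

lemma expect_count_eq (q : ℝ) (n k : ℕ) :
    expect q n (fun l => if l.count true = k then 1 else 0)
      = n.choose k * prob q true ^ k * prob q false ^ (n - k) := by
  induction n generalizing k with
  | zero => cases k <;> simp [expect]
  | succ n ih =>
    cases k with
    | zero =>
      have := ih 0
      simp only [Nat.choose_zero_right, Nat.cast_one, one_mul, pow_zero, Nat.sub_zero] at this ⊢
      simp [expect, this, expect_zero, pow_succ']
    | succ k =>
      have h1 := ih k
      have h2 := ih (k + 1)
      simp only [expect, List.count_cons, beq_self_eq_true, if_true, beq_iff_eq,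
        Bool.false_eq_true, if_false, add_zero, Nat.add_right_cancel_iff, h1, h2,
        Nat.choose_succ_succ, Nat.succ_eq_add_one, Nat.add_sub_add_right]
      rcases lt_or_ge k n with hk | hk
      · obtain ⟨m, rfl⟩ := Nat.exists_eq_add_of_lt hk
        have e1 : k + m + 1 - (k + 1) = m := by omega
        have e2 : k + m + 1 - k = m + 1 := by omega
        rw [e1, e2]
        push_cast
        ring
      -- The truncated exponent `n - (k + 1)` is harmless here because its binomial coefficient
      -- vanishes.
      · rw [Nat.choose_eq_zero_of_lt (show n < k + 1 by omega)]
        push_cast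
        ring

lemma expect_replicate (q : ℝ) (n : ℕ) :
    expect q n (fun l => if l = List.replicate n false then 1 else 0) = prob q false ^ n := by
  induction n with
  | zero => simp [expect]
  | succ n ih => simp [expect, List.replicate_succ, ih, expect_zero, pow_succ']

lemma expect_replicate_append (q : ℝ) (n : ℕ) :
    expect q (n + 1) (fun l => if l = List.replicate n false ++ [true] then 1 else 0)
      = prob q false ^ n * prob q true := by
  induction n with
  | zero => simp [expect]
  | succ n ih =>
    rw [expect]
    simp [List.replicate_succ, ih, expect_zero, pow_succ', mul_assoc]

section Law

variable {q τ₀ : ℝ}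

lemma measurePreserving_residual (hτ : 0 < τ₀) (hq : 0 < q) (hq1 : q < 1) :
    MeasurePreserving residual (law q τ₀) (law q τ₀) := by
  refine ⟨measurable_residual, Measure.ext_of_lintegral _ fun g hg => ?_⟩
  rw [lintegral_map hg measurable_residual,
    lintegral_bit_residual hτ hq hq1 (g := fun _ => g) (fun _ => hg), ← add_mul,
    prob_add hq hq1, one_mul]

/-- The miners of the first `n` blocks and the remaining waiting times are independent. -/
lemma lintegral_bits_mul (hτ : 0 < τ₀) (hq : 0 < q) (hq1 : q < 1) (n : ℕ) (F : List Bool → ℝ≥0∞)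
    {g : Path → ℝ≥0∞} (hg : Measurable g) :
    ∫⁻ ω, F (bits n ω) * g (residual^[n] ω) ∂law q τ₀ = expect q n F * ∫⁻ ω, g ω ∂law q τ₀ := by
  induction n generalizing F with
  | zero =>
    simp only [bits_zero, Function.iterate_zero, id, expect]
    rw [lintegral_const_mul _ hg]
  | succ n ih =>
    simp only [bits_succ, Function.iterate_succ_apply, expect]
    rw [lintegral_bit_residual hτ hq hq1
      (g := fun c ω => F (c :: bits n ω) * g (residual^[n] ω))
      (fun c => (measurable_comp_bits (fun l => F (c :: l)) n).mul (by fun_prop)),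
      ih fun l => F (false :: l), ih fun l => F (true :: l)]
    ring

lemma lintegral_bits (hτ : 0 < τ₀) (hq : 0 < q) (hq1 : q < 1) (n : ℕ) (F : List Bool → ℝ≥0∞) :
    ∫⁻ ω, F (bits n ω) ∂law q τ₀ = expect q n F := by
  have := isProbabilityMeasure_law hτ hq hq1
  simpa using lintegral_bits_mul hτ hq hq1 n F (g := fun _ => 1) measurable_const

end Law

lemma measurable_sInf_nat {Ω : Type*} [MeasurableSpace Ω] {p : Ω → ℕ → Prop}
    (hp : ∀ k, MeasurableSet {ω | p ω k}) : Measurable fun ω => sInf {n | p ω n} := by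
  classical
  refine measurable_to_countable' fun k => ?_
  have hk : MeasurableSet ({ω | p ω k} ∩ ⋂ j, ⋂ (_ : j < k), {ω | p ω j}ᶜ) :=
    (hp k).inter (.iInter fun j => .iInter fun _ => (hp j).compl)
  -- Since `sInf ∅ = 0`, the fibre over `0` also contains the points where `p` never holds.
  have h0 : MeasurableSet ({_ω | k = 0} ∩ ⋂ j, {ω | p ω j}ᶜ) :=
    (MeasurableSet.const _).inter (.iInter fun j => (hp j).compl)
  convert! hk.union h0 using 1
  ext ω
  simp only [Set.mem_preimage, Set.mem_singleton_iff, Set.mem_union, Set.mem_inter_iff,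
    Set.mem_iInter, Set.mem_compl_iff, Set.mem_ofPred_eq]
  constructor
  · rintro rfl
    by_cases h : {n | p ω n}.Nonempty
    · exact Or.inl ⟨Nat.sInf_mem h, fun j hj => Nat.notMem_of_lt_sInf hj⟩
    · rw [Set.not_nonempty_iff_eq_empty] at h
      exact Or.inr ⟨by simp [h], fun j hj => by simpa [h] using (show j ∈ {n | p ω n} from hj)⟩
  · rintro (⟨h1, h2⟩ | ⟨rfl, h⟩)
    · refine le_antisymm (Nat.sInf_le h1) ?_
      by_contra hlt
      exact h2 _ (not_le.1 hlt) (Nat.sInf_mem (⟨k, h1⟩ : {n | p ω n}.Nonempty))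
    · have : {n | p ω n} = ∅ := by ext n; simpa using h n
      simp [this]

lemma measurable_eval_nat {Ω β : Type*} [MeasurableSpace Ω] [MeasurableSpace β] {N : Ω → ℕ}
    (hN : Measurable N) {f : ℕ → Ω → β} (hf : ∀ n, Measurable (f n)) :
    Measurable fun ω => f (N ω) ω :=
  (measurable_from_prod_countable_right (f := fun p : ℕ × Ω => f p.1 p.2) hf).comp
    (hN.prodMk measurable_id)

/-! ### The pre-mining phase -/

/-- The number of blocks found before the first block of the attacker. -/
def firstAttack (ω : Path) : ℕ := sInf {n | bit (residual^[n] ω) = true}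

/-- The waiting times after the first block of the attacker. -/
def afterPreMine (ω : Path) : Path := residual^[firstAttack ω + 1] ω

@[fun_prop]
lemma measurable_firstAttack : Measurable firstAttack :=
  measurable_sInf_nat fun k =>
    (measurable_bit.comp (measurable_iterate_residual k)) (measurableSet_singleton true)

@[fun_prop]
lemma measurable_afterPreMine : Measurable afterPreMine :=
  measurable_eval_nat (f := fun n => residual^[n + 1]) measurable_firstAttack
    fun n => measurable_iterate_residual (n + 1)

lemma bits_eq_replicate {n : ℕ} {ω : Path} (h : ∀ k < n, bit (residual^[k] ω) = false) :
    bits n ω = List.replicate n false := by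
  induction n with
  | zero => rfl
  | succ n ih =>
    rw [bits_succ', ih fun k hk => h k (by omega), h n (by omega), List.replicate_succ']

lemma bits_firstAttack {ω : Path} (h : ∃ n, bit (residual^[n] ω) = true) :
    bits (firstAttack ω + 1) ω = List.replicate (firstAttack ω) false ++ [true] := by
  have h1 : bit (residual^[firstAttack ω] ω) = true :=
    Nat.sInf_mem (s := {n | bit (residual^[n] ω) = true}) h
  rw [bits_succ', h1, bits_eq_replicate fun k hk => ?_]
  simpa using Nat.notMem_of_lt_sInf hk

section Law

variable {q τ₀ : ℝ}

lemma ae_exists_attack (hτ : 0 < τ₀) (hq : 0 < q) (hq1 : q < 1) :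
    ∀ᵐ ω ∂law q τ₀, ∃ n, bit (residual^[n] ω) = true := by
  rw [ae_iff]
  have hlt : prob q false < 1 := by
    simp only [prob, Bool.false_eq_true, if_false]
    rw [ENNReal.ofReal_lt_one]
    linarith
  refine le_antisymm (ge_of_tendsto' (ENNReal.tendsto_pow_atTop_nhds_zero_of_lt_one hlt)
    fun n => ?_) (zero_le)
  rw [← expect_replicate, ← lintegral_bits hτ hq hq1]
  have hm : MeasurableSet {ω : Path | bits n ω = List.replicate n false} :=
    measurableSet_bits (fun l => l = List.replicate n false) n
  calc law q τ₀ _ ≤ law q τ₀ {ω | bits n ω = List.replicate n false} := by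
        refine measure_mono fun ω hω => ?_
        simp only [Set.mem_ofPred_eq, not_exists, Bool.not_eq_true] at hω
        exact bits_eq_replicate fun k _ => hω k
    _ = _ := by
        rw [← lintegral_indicator_one hm]
        refine lintegral_congr fun ω => ?_
        simp [Set.indicator_apply]

/-- The waiting times after the pre-mining phase are distributed as the original ones. -/
lemma measurePreserving_afterPreMine (hτ : 0 < τ₀) (hq : 0 < q) (hq1 : q < 1) :
    MeasurePreserving afterPreMine (law q τ₀) (law q τ₀) := by
  refine ⟨measurable_afterPreMine, Measure.ext_of_lintegral _ fun g hg => ?_⟩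
  rw [lintegral_map hg measurable_afterPreMine]
  let F : ℕ → List Bool → ℝ≥0∞ :=
    fun n l => if l = List.replicate n false ++ [true] then 1 else 0
  have h1 : ∀ ω : Path, (∃ n, bit (residual^[n] ω) = true) →
      g (afterPreMine ω) = ∑' n, F n (bits (n + 1) ω) * g (residual^[n + 1] ω) := by
    intro ω hω
    -- The events "the first attacker block comes after `n` honest ones" partition the space up to a
    -- null set, so one term survives.
    rw [tsum_eq_single (firstAttack ω)]
    · simp [F, bits_firstAttack hω, afterPreMine]
    · intro n hn
      have : bits (n + 1) ω ≠ List.replicate n false ++ [true] := by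
        intro h
        apply hn
        rw [bits_succ'] at h
        have h2 := List.append_inj h (by simp)
        refine le_antisymm ?_ (Nat.sInf_le (by simpa using h2.2))
        by_contra hlt
        rw [not_le] at hlt
        have h3 := congrArg (List.take (firstAttack ω + 1)) h2.1
        rw [take_bits hlt, bits_firstAttack hω, List.take_replicate, min_eq_left hlt,
          List.replicate_succ'] at h3
        simp at h3
      simp [F, this]
  have hm : ∀ n, AEMeasurable (fun ω => F n (bits (n + 1) ω) * g (residual^[n + 1] ω))
      (law q τ₀) :=
    fun n => ((measurable_comp_bits (F n) (n + 1)).mul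
      (hg.comp (measurable_iterate_residual (n + 1)))).aemeasurable
  rw [lintegral_congr_ae ((ae_exists_attack hτ hq hq1).mono h1), lintegral_tsum hm]
  simp_rw [lintegral_bits_mul hτ hq hq1 _ _ hg, F, expect_replicate_append, mul_assoc]
  -- The geometric probabilities `(1 - q) ^ n * q` sum to one.
  rw [ENNReal.tsum_mul_right, ENNReal.tsum_geometric, ← prob_add hq hq1, ← mul_assoc,
    ENNReal.add_sub_cancel_left (by simp [prob]), ENNReal.inv_mul_cancel, one_mul]
  · simpa [prob] using hq
  · simp [prob]

lemma ae_pos_law (hτ : 0 < τ₀) (hq : 0 < q) (hq1 : q < 1) :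
    ∀ᵐ ω ∂law q τ₀, ∀ k, 0 < ω.1 k ∧ 0 < ω.2 k := by
  have := isProbabilityMeasure_expMeasure (r := (1 - q) / τ₀) (div_pos (by linarith) hτ)
  have := isProbabilityMeasure_expMeasure (r := q / τ₀) (div_pos hq hτ)
  rw [ae_all_iff]
  intro k
  have h1 : ∀ᵐ ω ∂law q τ₀, 0 < ω.1 k := by
    have : MeasurePreserving (fun ω : Path => ω.1 k) (law q τ₀) (expMeasure ((1 - q) / τ₀)) :=
      (measurePreserving_eval_infinitePi _ k).comp measurePreserving_fst
    exact this.quasiMeasurePreserving.ae (ae_pos_expMeasure _)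
  have h2 : ∀ᵐ ω ∂law q τ₀, 0 < ω.2 k := by
    have : MeasurePreserving (fun ω : Path => ω.2 k) (law q τ₀) (expMeasure (q / τ₀)) :=
      (measurePreserving_eval_infinitePi _ k).comp measurePreserving_snd
    exact this.quasiMeasurePreserving.ae (ae_pos_expMeasure _)
  exact h1.and h2

lemma lintegral_fst_zero (hτ : 0 < τ₀) (hq : 0 < q) (hq1 : q < 1) :
    ∫⁻ ω, ENNReal.ofReal (ω.1 0) ∂law q τ₀ = ENNReal.ofReal (τ₀ / (1 - q)) := by
  have := isProbabilityMeasure_law hτ hq hq1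
  rw [lintegral_law_seqCons_fst hτ hq hq1 (by fun_prop)]
  simp [lintegral_id_expMeasure (div_pos (by linarith : 0 < 1 - q) hτ)]

lemma lintegral_snd_zero (hτ : 0 < τ₀) (hq : 0 < q) (hq1 : q < 1) :
    ∫⁻ ω, ENNReal.ofReal (ω.2 0) ∂law q τ₀ = ENNReal.ofReal (τ₀ / q) := by
  have := isProbabilityMeasure_law hτ hq hq1
  rw [lintegral_law_seqCons_snd hτ hq hq1 (by fun_prop)]
  simp [lintegral_id_expMeasure (div_pos hq hτ)]

end Law

/-! ### From continuous time to the sequence of blocks -/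

lemma blockCount_eq {x : ℕ → ℝ} (hx : ∀ k, 0 < x k) {m : ℕ} {t : ℝ}
    (h1 : ∑ k ∈ Finset.range m, x k ≤ t) (h2 : t < ∑ k ∈ Finset.range (m + 1), x k) :
    blockCount x t = m := by
  have hmono : Monotone fun n => ∑ k ∈ Finset.range n, x k :=
    monotone_nat_of_le_succ fun n => by
      rw [Finset.sum_range_succ]; linarith [hx n]
  have : {n : ℕ | 1 ≤ n ∧ ∑ k ∈ Finset.range n, x k ≤ t} = (Finset.Icc 1 m : Finset ℕ) := by
    ext n
    simp only [Set.mem_ofPred_eq, Finset.coe_Icc, Set.mem_Icc, and_congr_right_iff]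
    intro _
    constructor
    · intro h
      by_contra hn
      exact absurd (hmono (show m + 1 ≤ n by omega)) (by simp only; linarith)
    · intro h
      exact (hmono h).trans h1
  rw [blockCount, this, Set.ncard_coe_finset]
  simp

/-- All waiting times, between any two consecutive blocks, are positive. -/
def Regular (ω : Path) : Prop := ∀ n k, 0 < (residual^[n] ω).1 k ∧ 0 < (residual^[n] ω).2 k

/-- The time at which the `n`-th block is found. -/
def time (n : ℕ) (ω : Path) : ℝ := ∑ i ∈ Finset.range n, wait (residual^[i] ω)

/-- The number of honest blocks among the first `n`. -/
abbrev honestCount (n : ℕ) (ω : Path) : ℕ := (bits n ω).count false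

/-- The number of blocks of the attacker among the first `n`. -/
abbrev attackCount (n : ℕ) (ω : Path) : ℕ := (bits n ω).count true

lemma honestCount_add_attackCount (n : ℕ) (ω : Path) :
    honestCount n ω + attackCount n ω = n := by
  rw [honestCount, attackCount, List.count_false_add_count_true, length_bits]

lemma time_succ (n : ℕ) (ω : Path) : time (n + 1) ω = time n ω + wait (residual^[n] ω) :=
  Finset.sum_range_succ _ _

lemma time_add (m n : ℕ) (ω : Path) : time (m + n) ω = time m ω + time n (residual^[m] ω) := by
  rw [time, Finset.sum_range_add]
  simp only [time, ← Function.iterate_add_apply, add_comm m]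

lemma Regular.wait_pos {ω : Path} (h : Regular ω) (n : ℕ) : 0 < wait (residual^[n] ω) :=
  lt_min (h n 0).1 (h n 0).2

lemma Regular.iterate {ω : Path} (h : Regular ω) (m : ℕ) : Regular (residual^[m] ω) := by
  intro n k
  rw [← Function.iterate_add_apply]
  exact h _ k

lemma Regular.time_strictMono {ω : Path} (h : Regular ω) : StrictMono fun n => time n ω :=
  strictMono_nat_of_lt_succ fun n => by rw [time_succ]; linarith [h.wait_pos n]

lemma honestCount_succ (n : ℕ) (ω : Path) : honestCount (n + 1) ω
    = honestCount n ω + if bit (residual^[n] ω) = true then 0 else 1 := by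
  rw [honestCount, bits_succ', List.count_append]
  cases bit (residual^[n] ω) <;> simp

lemma attackCount_succ (n : ℕ) (ω : Path) : attackCount (n + 1) ω
    = attackCount n ω + if bit (residual^[n] ω) = true then 1 else 0 := by
  rw [attackCount, bits_succ', List.count_append]
  cases bit (residual^[n] ω) <;> simp

/-- An invariant tying residual waits to the original clock: an attacker's block shortens the
pending honest wait by the elapsed time, an honest block consumes it. The equality needs at least
one pending wait, hence `k + 1`; with none, only the inequality holds in general. -/
lemma Regular.sum_fst {ω : Path} (h : Regular ω) (n : ℕ) :
    ∑ i ∈ Finset.range (honestCount n ω), ω.1 i ≤ time n ω ∧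
    ∀ k, time n ω + ∑ i ∈ Finset.range (k + 1), (residual^[n] ω).1 i
      = ∑ i ∈ Finset.range (honestCount n ω + (k + 1)), ω.1 i := by
  induction n with
  | zero => simp [time, honestCount]
  | succ n ih =>
    obtain ⟨ih1, ih2⟩ := ih
    have hpos := h.wait_pos n
    rw [honestCount_succ, time_succ, Function.iterate_succ_apply']
    set η := residual^[n] ω with hη
    by_cases hb : η.2 0 ≤ η.1 0
    · have hw : wait η = η.2 0 := min_eq_right hb
      have hr : (residual η).1 = seqCons (η.1 0 - η.2 0) (seqTail η.1) := by
        simp [residual, hb]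
      simp only [bit, hb, decide_true, if_true, add_zero]
      refine ⟨by linarith, fun k => ?_⟩
      rw [← ih2 k, hr, hw, Finset.sum_range_succ', Finset.sum_range_succ']
      simp
      ring
    · have hw : wait η = η.1 0 := min_eq_left (not_le.1 hb).le
      have hr : (residual η).1 = seqTail η.1 := by simp [residual, hb]
      simp only [bit, hb, decide_false, Bool.false_eq_true, if_false]
      refine ⟨?_, fun k => ?_⟩
      · have := ih2 0
        simp only [zero_add, Finset.sum_range_one] at this
        rw [hw, this]
      · rw [show honestCount n ω + 1 + (k + 1) = honestCount n ω + ((k + 1) + 1) by ring,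
          ← ih2 (k + 1), hr, hw, Finset.sum_range_succ' _ (k + 1)]
        simp
        ring

lemma Regular.sum_snd {ω : Path} (h : Regular ω) (n : ℕ) :
    ∑ i ∈ Finset.range (attackCount n ω), ω.2 i ≤ time n ω ∧
    ∀ k, time n ω + ∑ i ∈ Finset.range (k + 1), (residual^[n] ω).2 i
      = ∑ i ∈ Finset.range (attackCount n ω + (k + 1)), ω.2 i := by
  induction n with
  | zero => simp [time, attackCount]
  | succ n ih =>
    obtain ⟨ih1, ih2⟩ := ih
    have hpos := h.wait_pos n
    rw [attackCount_succ, time_succ, Function.iterate_succ_apply']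
    set η := residual^[n] ω with hη
    by_cases hb : η.2 0 ≤ η.1 0
    · have hw : wait η = η.2 0 := min_eq_right hb
      have hr : (residual η).2 = seqTail η.2 := by simp [residual, hb]
      simp only [bit, hb, decide_true, if_true]
      refine ⟨?_, fun k => ?_⟩
      · have := ih2 0
        simp only [zero_add, Finset.sum_range_one] at this
        rw [hw, this]
      · rw [show attackCount n ω + 1 + (k + 1) = attackCount n ω + ((k + 1) + 1) by ring,
          ← ih2 (k + 1), hr, hw, Finset.sum_range_succ' _ (k + 1)]
        simp
        ring
    · have hw : wait η = η.1 0 := min_eq_left (not_le.1 hb).le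
      have hr : (residual η).2 = seqCons (η.2 0 - η.1 0) (seqTail η.2) := by
        simp [residual, hb]
      simp only [bit, hb, decide_false, Bool.false_eq_true, if_false, add_zero]
      refine ⟨by linarith, fun k => ?_⟩
      rw [← ih2 k, hr, hw, Finset.sum_range_succ', Finset.sum_range_succ']
      simp
      ring

/-- Between the `n`-th and the next block, the counting processes count the first `n` miners. -/
lemma Regular.blockCount_of_mem {ω : Path} (h : Regular ω) {n : ℕ} {t : ℝ}
    (h1 : time n ω ≤ t) (h2 : t < time (n + 1) ω) :
    blockCount ω.1 t = honestCount n ω ∧ blockCount ω.2 t = attackCount n ω := by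
  obtain ⟨a1, a2⟩ := h.sum_fst n
  obtain ⟨b1, b2⟩ := h.sum_snd n
  have a3 := a2 0
  have b3 := b2 0
  simp only [zero_add, Finset.sum_range_one] at a3 b3
  rw [time_succ] at h2
  have := min_le_left ((residual^[n] ω).1 0) ((residual^[n] ω).2 0)
  have := min_le_right ((residual^[n] ω).1 0) ((residual^[n] ω).2 0)
  unfold wait at h2
  have hx : ∀ k, 0 < ω.1 k := fun k => (h 0 k).1
  have hy : ∀ k, 0 < ω.2 k := fun k => (h 0 k).2
  exact ⟨blockCount_eq hx (by linarith) (by linarith),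
    blockCount_eq hy (by linarith) (by linarith)⟩

/-- The attack has led to a successful double spend when the miners of the blocks since the
pre-mining phase are `l`. -/
def ListSucceeds (z : ℕ) (l : List Bool) : Prop :=
  z ≤ l.count false ∧ l.count false < 1 + l.count true

/-- There is a reason to end the attack when the miners of the blocks since the pre-mining phase
are `l`. -/
def Ended (z A : ℕ) (l : List Bool) : Prop :=
  ListSucceeds z l ∨ 1 + l.count true + A ≤ l.count false

/-- The number of blocks found between the pre-mining phase and the end of the attack, as a
function of the waiting times after the pre-mining phase. -/
def endIndex (z A : ℕ) (η : Path) : ℕ := sInf {n | Ended z A (bits n η)}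

section Deterministic

variable {z A : ℕ} {ω : Path}

/-- Before that block the attacker's count is zero, so by `Regular.sum_snd` elapsed time plus his
pending wait is `ω.2 0`. -/
lemma Regular.preMineTime_eq (h : Regular ω) (hJ : ∃ n, bit (residual^[n] ω) = true) :
    preMineTime ω = time (firstAttack ω + 1) ω := by
  have h1 : bit (residual^[firstAttack ω] ω) = true :=
    Nat.sInf_mem (s := {n | bit (residual^[n] ω) = true}) hJ
  have h2 : bits (firstAttack ω) ω = List.replicate (firstAttack ω) false :=
    bits_eq_replicate fun k hk => by simpa using Nat.notMem_of_lt_sInf hk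
  have h3 := (h.sum_snd (firstAttack ω)).2 0
  simp only [zero_add, Finset.sum_range_one, attackCount, h2, List.count_replicate] at h3
  simp only [beq_iff_eq, Bool.false_eq_true, if_false, zero_add, Finset.sum_range_one] at h3
  rw [time_succ, wait, min_eq_right (by simpa [bit] using h1), h3, preMineTime]

/-- Honest blocks found during pre-mining cancel in `officialBlocks`; the pre-mined block is the
extra `1`. -/
lemma Regular.blocks_of_mem (h : Regular ω) (hJ : ∃ n, bit (residual^[n] ω) = true) {n : ℕ} {t : ℝ}
    (h1 : preMineTime ω + time n (afterPreMine ω) ≤ t)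
    (h2 : t < preMineTime ω + time (n + 1) (afterPreMine ω)) :
    officialBlocks ω t = honestCount n (afterPreMine ω) ∧
      secretBlocks ω t = 1 + attackCount n (afterPreMine ω) := by
  have hp := h.preMineTime_eq hJ
  rw [hp, afterPreMine, ← time_add] at h1 h2
  rw [← add_assoc] at h2
  obtain ⟨e1, e2⟩ := h.blockCount_of_mem h1 h2
  obtain ⟨f1, -⟩ := h.blockCount_of_mem hp.ge
    (hp.le.trans_lt (h.time_strictMono (Nat.lt_succ_self _)))
  rw [officialBlocks, secretBlocks, e1, e2, f1]
  simp only [honestCount, attackCount, bits_add _ n, List.count_append, bits_firstAttack hJ,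
    afterPreMine]
  simp [List.count_replicate]

lemma Regular.ended_of_mem (h : Regular ω) (hJ : ∃ n, bit (residual^[n] ω) = true) {n : ℕ} {t : ℝ}
    (h1 : preMineTime ω + time n (afterPreMine ω) ≤ t)
    (h2 : t < preMineTime ω + time (n + 1) (afterPreMine ω)) :
    (Succeeds z ω t ↔ ListSucceeds z (bits n (afterPreMine ω))) ∧
    ((Succeeds z ω t ∨ GivesUp A ω t) ↔ Ended z A (bits n (afterPreMine ω))) := by
  obtain ⟨e1, e2⟩ := h.blocks_of_mem hJ h1 h2
  simp only [Succeeds, GivesUp, Ended, ListSucceeds, e1, e2, and_self]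

/-- The counts are constant between consecutive blocks, so the first end time is the time of a
block. -/
lemma Regular.isLeast_endTimes (h : Regular ω) (hJ : ∃ n, bit (residual^[n] ω) = true)
    (hN : ∃ n, Ended z A (bits n (afterPreMine ω))) :
    IsLeast (endTimes z A ω)
      (preMineTime ω + time (endIndex z A (afterPreMine ω)) (afterPreMine ω)) := by
  have hη : Regular (afterPreMine ω) := h.iterate _
  set η := afterPreMine ω with hdef
  have hend : Ended z A (bits (endIndex z A η) η) :=
    Nat.sInf_mem (s := {n | Ended z A (bits n η)}) hN
  have hmono := hη.time_strictMono
  have h0 : ∀ n, 0 ≤ time n η := fun n => Finset.sum_nonneg fun i _ => (hη.wait_pos i).le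
  refine ⟨⟨by linarith [h0 (endIndex z A η)], ?_⟩, ?_⟩
  · exact ((h.ended_of_mem hJ le_rfl
      (by simpa using hmono (Nat.lt_succ_self (endIndex z A η)))).2).2 hend
  · rintro t ⟨ht, hE⟩
    by_contra hlt
    rw [not_le] at hlt
    have hex : ∃ n, t < preMineTime ω + time n η := ⟨_, hlt⟩
    classical
    -- Index `0` is excluded because `time 0 = 0` and `t` is not before the pre-mining time; hence
    -- `t` lies between blocks `m` and `m + 1`.
    obtain ⟨m, hm⟩ : ∃ m, Nat.find hex = m + 1 := by
      refine Nat.exists_eq_succ_of_ne_zero fun h00 => ?_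
      have := Nat.find_spec hex
      rw [h00] at this
      simp [time] at this
      linarith
    have hu : t < preMineTime ω + time (m + 1) η := hm ▸ Nat.find_spec hex
    have hl : preMineTime ω + time m η ≤ t := not_lt.1 (Nat.find_min hex (by omega))
    have hmE : Ended z A (bits m η) := ((h.ended_of_mem hJ hl hu).2).1 hE
    have hmN : endIndex z A η ≤ m := Nat.sInf_le hmE
    have := hmono.monotone hmN
    linarith

/-- The revenue, as a function of the waiting times after the pre-mining phase. -/
def reward (b v : ℝ) (z A : ℕ) (η : Path) : ℝ :=
  open scoped Classical in
  if ListSucceeds z (bits (endIndex z A η) η) then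
    v + b * (1 + attackCount (endIndex z A η) η : ℕ) else 0

lemma Regular.duration_eq (h : Regular ω) (hJ : ∃ n, bit (residual^[n] ω) = true)
    (hN : ∃ n, Ended z A (bits n (afterPreMine ω))) :
    duration z A ω
      = preMineTime ω + time (endIndex z A (afterPreMine ω)) (afterPreMine ω) :=
  (h.isLeast_endTimes hJ hN).csInf_eq

lemma Regular.revenue_eq (h : Regular ω) (hJ : ∃ n, bit (residual^[n] ω) = true)
    (hN : ∃ n, Ended z A (bits n (afterPreMine ω))) (b v : ℝ) :
    revenue b v z A ω = reward b v z A (afterPreMine ω) := by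
  have hη : Regular (afterPreMine ω) := h.iterate _
  have hmono := hη.time_strictMono
  have hlt : duration z A ω
      < preMineTime ω + time (endIndex z A (afterPreMine ω) + 1) (afterPreMine ω) := by
    rw [h.duration_eq hJ hN]
    simpa using hmono (Nat.lt_succ_self (endIndex z A (afterPreMine ω)))
  rw [revenue, reward, (h.blocks_of_mem hJ (h.duration_eq hJ hN).ge hlt).2]
  have hiff := (h.ended_of_mem (z := z) (A := A) hJ (h.duration_eq hJ hN).ge hlt).1
  by_cases hs : Succeeds z ω (duration z A ω)
  · rw [if_pos hs, if_pos (hiff.1 hs)]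
  · rw [if_neg hs, if_neg (hiff.not.1 hs)]

end Deterministic

/-! ### Expected length of the attack -/

/-- The attack has not ended yet when the miners since the pre-mining phase are `l`. -/
def Running (z A : ℕ) (l : List Bool) : Prop := ∀ k ≤ l.length, ¬ Ended z A (l.take k)

lemma running_bits_iff {z A n : ℕ} {ω : Path} :
    Running z A (bits n ω) ↔ ∀ k ≤ n, ¬ Ended z A (bits k ω) := by
  simp only [Running, length_bits]
  exact forall₂_congr fun k hk => by rw [take_bits hk]

lemma running_bits_iff_lt {z A n : ℕ} {ω : Path} (h : ∃ n, Ended z A (bits n ω)) :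
    Running z A (bits n ω) ↔ n < endIndex z A ω := by
  rw [running_bits_iff]
  constructor
  · intro hr
    by_contra hn
    exact hr _ (not_lt.1 hn) (Nat.sInf_mem (s := {n | Ended z A (bits n ω)}) h)
  · intro hn k hk
    exact Nat.notMem_of_lt_sInf (s := {n | Ended z A (bits n ω)}) (hk.trans_lt hn)

open scoped Classical in
/-- The number of blocks of the miner `c` among the first `n` that are found before the end of the
attack, the block that ends it included. -/
def runCount (z A : ℕ) (c : Bool) (n : ℕ) (ω : Path) : ℕ :=
  ∑ k ∈ Finset.range n, if Running z A (bits k ω) ∧ bit (residual^[k] ω) = c then 1 else 0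

/-- While the attack runs, the honest excess is at most `A`; the block that ends it adds at most
one, and the counts then freeze. -/
lemma runCount_false_le (z A n : ℕ) (ω : Path) :
    runCount z A false n ω ≤ A + 1 + runCount z A true n ω := by
  classical
  -- The induction must also know that the stopped counts are the true counts as long as the attack
  -- runs.
  suffices h : runCount z A false n ω ≤ A + 1 + runCount z A true n ω ∧
      (Running z A (bits n ω) → runCount z A false n ω = honestCount n ω ∧
        runCount z A true n ω = attackCount n ω) from h.1
  induction n with
  | zero => simp [runCount, honestCount, attackCount]
  | succ n ih =>
    obtain ⟨ih1, ih2⟩ := ih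
    have hs : ∀ c, runCount z A c (n + 1) ω = runCount z A c n ω
        + if Running z A (bits n ω) ∧ bit (residual^[n] ω) = c then 1 else 0 :=
      fun c => Finset.sum_range_succ _ _
    rw [hs, hs, honestCount_succ, attackCount_succ]
    by_cases hr : Running z A (bits n ω)
    · obtain ⟨e1, e2⟩ := ih2 hr
      have hE := running_bits_iff.1 hr n le_rfl
      simp only [Ended, not_or, not_le] at hE
      have : honestCount n ω < 1 + attackCount n ω + A := hE.2
      cases hb : bit (residual^[n] ω) <;> simp [hr] <;> omega
    · have hr' : ¬ Running z A (bits (n + 1) ω) := fun h =>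
        hr (running_bits_iff.2 fun k hk => running_bits_iff.1 h k (by omega))
      simp [hr, hr', ih1]

section Law

variable {q τ₀ : ℝ}

lemma measurableSet_bit_eq (c : Bool) : MeasurableSet {ω | bit ω = c} :=
  measurable_bit (measurableSet_singleton c)

lemma lintegral_bit_eq (hτ : 0 < τ₀) (hq : 0 < q) (hq1 : q < 1) (c : Bool) :
    ∫⁻ ω, (if bit ω = c then 1 else 0) ∂law q τ₀ = prob q c := by
  have := isProbabilityMeasure_law hτ hq hq1
  rw [lintegral_bit_residual hτ hq hq1 (g := fun d _ => if d = c then 1 else 0)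
    fun d => measurable_const]
  cases c <;> simp

open scoped Classical in
/-- The probability that the attack goes on after `n` blocks. -/
def runProb (z A : ℕ) (q : ℝ) (n : ℕ) : ℝ≥0∞ :=
  expect q n fun l => if Running z A l then 1 else 0

-- Whether the attack still runs after `n` blocks depends on these blocks only, hence is independent
-- of what follows.
open scoped Classical in
lemma lintegral_running_mul (hτ : 0 < τ₀) (hq : 0 < q) (hq1 : q < 1) (z A n : ℕ)
    {g : Path → ℝ≥0∞} (hg : Measurable g) :
    ∫⁻ ω, (if Running z A (bits n ω) then g (residual^[n] ω) else 0) ∂law q τ₀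
      = runProb z A q n * ∫⁻ ω, g ω ∂law q τ₀ := by
  rw [runProb, ← lintegral_bits_mul hτ hq hq1 n _ hg]
  refine lintegral_congr fun ω => ?_
  split_ifs <;> simp

lemma lintegral_runCount (hτ : 0 < τ₀) (hq : 0 < q) (hq1 : q < 1) (z A n : ℕ) (c : Bool) :
    ∫⁻ ω, (runCount z A c n ω : ℝ≥0∞) ∂law q τ₀
      = (∑ k ∈ Finset.range n, runProb z A q k) * prob q c := by
  classical
  have hm : Measurable fun ω => if bit ω = c then (1 : ℝ≥0∞) else 0 :=
    Measurable.ite (measurableSet_bit_eq c) measurable_const measurable_const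
  simp only [runCount, Nat.cast_sum, Nat.cast_ite, Nat.cast_one, Nat.cast_zero, ite_and]
  rw [lintegral_finsetSum, Finset.sum_mul]
  · refine Finset.sum_congr rfl fun k _ => ?_
    rw [lintegral_running_mul hτ hq hq1 z A k hm, lintegral_bit_eq hτ hq hq1]
  · exact fun k _ => Measurable.ite (measurableSet_bits _ k)
      (hm.comp (measurable_iterate_residual k)) measurable_const

lemma runProb_le_one (hq : 0 < q) (hq1 : q < 1) (z A n : ℕ) : runProb z A q n ≤ 1 := by
  classical
  calc runProb z A q n ≤ expect q n fun l => 1 ^ l.count true :=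
        expect_mono q fun l _ => by split_ifs <;> simp
    _ = 1 := by rw [expect_pow_count, mul_one, prob_add hq hq1, one_pow]

/-- The expected number of blocks between the pre-mining phase and the end of the attack is
bounded. -/
lemma tsum_runProb_le (hτ : 0 < τ₀) (hq : 0 < q) (hq2 : q < 1 / 2) (z A : ℕ) :
    ∑' n, runProb z A q n ≤ ENNReal.ofReal ((A + 1) / (1 - 2 * q)) := by
  have hq1 : q < 1 := by linarith
  have := isProbabilityMeasure_law hτ hq hq1
  refine ENNReal.tsum_le_of_sum_range_le fun n => ?_
  have hfin : ∑ k ∈ Finset.range n, runProb z A q k ≠ ∞ :=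
    ENNReal.sum_ne_top.2 fun k _ => ne_top_of_le_ne_top ENNReal.one_ne_top
      (runProb_le_one hq hq1 z A k)
  -- In means, with `R` the partial sum, this reads `(1 - q) * R ≤ A + 1 + q * R`. As `R` is finite
  -- it can be solved for, uniformly in `n`.
  have h1 : ∫⁻ ω, (runCount z A false n ω : ℝ≥0∞) ∂law q τ₀
      ≤ ∫⁻ ω, ((A + 1 : ℝ≥0∞) + (runCount z A true n ω : ℝ≥0∞)) ∂law q τ₀ :=
    lintegral_mono fun ω => by
      rw [← Nat.cast_one, ← Nat.cast_add, ← Nat.cast_add]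
      exact Nat.cast_le.2 (runCount_false_le z A n ω)
  rw [lintegral_add_left measurable_const, lintegral_const, measure_univ, mul_one,
    lintegral_runCount hτ hq hq1, lintegral_runCount hτ hq hq1] at h1
  set R := ∑ k ∈ Finset.range n, runProb z A q k with hR
  have h2 := ENNReal.toReal_mono (by simp [prob, ENNReal.mul_eq_top, hfin]) h1
  rw [ENNReal.toReal_add (by simp) (by simp [prob, ENNReal.mul_eq_top, hfin]),
    ENNReal.toReal_mul, ENNReal.toReal_mul] at h2
  simp only [prob, Bool.false_eq_true, if_false, if_true] at h2
  rw [ENNReal.toReal_ofReal hq.le, ENNReal.toReal_ofReal (by linarith),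
    ENNReal.toReal_add (by simp) (by simp)] at h2
  simp only [ENNReal.toReal_natCast, ENNReal.toReal_one] at h2
  rw [← ENNReal.ofReal_toReal hfin]
  refine ENNReal.ofReal_le_ofReal ?_
  rw [le_div_iff₀ (by linarith)]
  linarith

open scoped Classical in
lemma lintegral_tsum_running (hτ : 0 < τ₀) (hq : 0 < q) (hq1 : q < 1) (z A : ℕ)
    {g : Path → ℝ≥0∞} (hg : Measurable g) :
    ∫⁻ ω, ∑' n, (if Running z A (bits n ω) then g (residual^[n] ω) else 0) ∂law q τ₀
      = (∑' n, runProb z A q n) * ∫⁻ ω, g ω ∂law q τ₀ := by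
  have hm : ∀ n, AEMeasurable
      (fun ω => if Running z A (bits n ω) then g (residual^[n] ω) else 0) (law q τ₀) :=
    fun n => (Measurable.ite (measurableSet_bits _ n)
      (hg.comp (measurable_iterate_residual n)) measurable_const).aemeasurable
  rw [lintegral_tsum hm, ← ENNReal.tsum_mul_right]
  exact tsum_congr fun n => lintegral_running_mul hτ hq hq1 z A n hg

/-- An attack that never ends would make the number of running steps infinite, but its mean is
finite. -/
lemma ae_exists_ended (hτ : 0 < τ₀) (hq : 0 < q) (hq2 : q < 1 / 2) (z A : ℕ) :
    ∀ᵐ η ∂law q τ₀, ∃ n, Ended z A (bits n η) := by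
  classical
  have hq1 : q < 1 := by linarith
  have := isProbabilityMeasure_law hτ hq hq1
  have h := lintegral_tsum_running hτ hq hq1 z A (g := fun _ => 1) measurable_const
  have hfin : (∑' n, runProb z A q n) * ∫⁻ _, 1 ∂law q τ₀ ≠ ∞ := by
    rw [lintegral_one, measure_univ, mul_one]
    exact ne_top_of_le_ne_top ENNReal.ofReal_ne_top (tsum_runProb_le hτ hq hq2 z A)
  rw [← h] at hfin
  have hm : Measurable fun ω => ∑' n, (if Running z A (bits n ω) then (1 : ℝ≥0∞) else 0) :=
    Measurable.tsum fun n =>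
      Measurable.ite (measurableSet_bits _ n) measurable_const measurable_const
  filter_upwards [ae_lt_top hm hfin] with ω hω
  by_contra hne
  push Not at hne
  have hr : ∀ n, Running z A (bits n ω) := fun n => running_bits_iff.2 fun k _ => hne k
  simp only [hr, if_true] at hω
  rw [ENNReal.tsum_const_eq_top_of_ne_zero one_ne_zero] at hω
  exact lt_irrefl _ hω

lemma ae_regular (hτ : 0 < τ₀) (hq : 0 < q) (hq1 : q < 1) : ∀ᵐ ω ∂law q τ₀, Regular ω :=
  ae_all_iff.2 fun n =>
    ((measurePreserving_residual hτ hq hq1).iterate n).quasiMeasurePreserving.ae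
      (ae_pos_law hτ hq hq1)

lemma ae_exists_ended_afterPreMine (hτ : 0 < τ₀) (hq : 0 < q) (hq2 : q < 1 / 2) (z A : ℕ) :
    ∀ᵐ ω ∂law q τ₀, ∃ n, Ended z A (bits n (afterPreMine ω)) :=
  (measurePreserving_afterPreMine hτ hq (by linarith)).quasiMeasurePreserving.ae
    (ae_exists_ended hτ hq hq2 z A)

lemma ae_nonempty_endTimes (hτ : 0 < τ₀) (hq : 0 < q) (hq2 : q < 1 / 2) (z A : ℕ) :
    ∀ᵐ ω ∂law q τ₀, (endTimes z A ω).Nonempty := by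
  have hq1 : q < 1 := by linarith
  filter_upwards [ae_regular hτ hq hq1, ae_exists_attack hτ hq hq1,
    ae_exists_ended_afterPreMine hτ hq hq2 z A] with ω h1 h2 h3
  exact ⟨_, (h1.isLeast_endTimes h2 h3).1⟩

lemma measurable_endIndex (z A : ℕ) : Measurable (endIndex z A) :=
  measurable_sInf_nat fun k => measurableSet_bits _ k

lemma measurable_time (n : ℕ) : Measurable (time n) :=
  Finset.measurable_sum _ fun i _ => measurable_wait.comp (measurable_iterate_residual i)

/-- The duration of the attack after the pre-mining phase. -/
def attackTime (z A : ℕ) (η : Path) : ℝ := time (endIndex z A η) η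

@[fun_prop]
lemma measurable_attackTime (z A : ℕ) : Measurable (attackTime z A) :=
  measurable_eval_nat (measurable_endIndex z A) measurable_time

lemma Regular.attackTime_nonneg {η : Path} (h : Regular η) (z A : ℕ) : 0 ≤ attackTime z A η := by
  unfold attackTime time
  exact Finset.sum_nonneg fun i _ => (h.wait_pos i).le

lemma duration_ae_eq (hτ : 0 < τ₀) (hq : 0 < q) (hq2 : q < 1 / 2) (z A : ℕ) :
    duration z A =ᵐ[law q τ₀] fun ω => ω.2 0 + attackTime z A (afterPreMine ω) := by
  have hq1 : q < 1 := by linarith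
  filter_upwards [ae_regular hτ hq hq1, ae_exists_attack hτ hq hq1,
    ae_exists_ended_afterPreMine hτ hq hq2 z A] with ω h1 h2 h3
  exact h1.duration_eq h2 h3

lemma lintegral_attackTime_le (hτ : 0 < τ₀) (hq : 0 < q) (hq2 : q < 1 / 2) (z A : ℕ) :
    ∫⁻ η, ENNReal.ofReal (attackTime z A η) ∂law q τ₀
      ≤ ENNReal.ofReal ((A + 1) / (1 - 2 * q) * (τ₀ / (1 - q))) := by
  classical
  have hq1 : q < 1 := by linarith
  have hle : ∫⁻ ω, ENNReal.ofReal (wait ω) ∂law q τ₀ ≤ ENNReal.ofReal (τ₀ / (1 - q)) := by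
    rw [← lintegral_fst_zero hτ hq hq1]
    exact lintegral_mono fun ω => ENNReal.ofReal_le_ofReal (min_le_left _ _)
  have h := lintegral_tsum_running hτ hq hq1 z A (g := fun ω => ENNReal.ofReal (wait ω))
    (by fun_prop)
  rw [ENNReal.ofReal_mul (by apply div_nonneg <;> [positivity; linarith])]
  calc _ = _ := lintegral_congr_ae ?_
    _ = _ := h
    _ ≤ _ := mul_le_mul' (tsum_runProb_le hτ hq hq2 z A) hle
  filter_upwards [ae_regular hτ hq hq1, ae_exists_ended hτ hq hq2 z A] with η h1 h2
  simp only [running_bits_iff_lt h2]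
  rw [attackTime, time, ENNReal.ofReal_sum_of_nonneg fun i _ => (h1.wait_pos i).le,
    tsum_eq_sum (s := Finset.range (endIndex z A η)) fun n hn => by simp_all]
  exact Finset.sum_congr rfl fun i hi => by rw [if_pos (Finset.mem_range.1 hi)]

lemma integrable_of_lintegral_le {Ω : Type*} [MeasurableSpace Ω] {μ : Measure Ω} {f : Ω → ℝ}
    (hm : Measurable f) (h0 : ∀ᵐ ω ∂μ, 0 ≤ f ω) {c : ℝ} (hc : 0 ≤ c)
    (h : ∫⁻ ω, ENNReal.ofReal (f ω) ∂μ ≤ ENNReal.ofReal c) :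
    Integrable f μ ∧ ∫ ω, f ω ∂μ ≤ c := by
  refine ⟨⟨hm.aestronglyMeasurable, ?_⟩, ?_⟩
  · rw [hasFiniteIntegral_iff_ofReal h0]
    exact h.trans_lt ENNReal.ofReal_lt_top
  · rw [integral_eq_lintegral_of_nonneg_ae h0 hm.aestronglyMeasurable]
    exact ENNReal.toReal_le_of_le_ofReal hc h

lemma integrable_attackTime (hτ : 0 < τ₀) (hq : 0 < q) (hq2 : q < 1 / 2) (z A : ℕ) :
    Integrable (attackTime z A) (law q τ₀) ∧
      ∫ η, attackTime z A η ∂law q τ₀ ≤ (A + 1) / (1 - 2 * q) * (τ₀ / (1 - q)) :=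
  integrable_of_lintegral_le (measurable_attackTime z A)
    ((ae_regular hτ hq (by linarith)).mono fun η h => h.attackTime_nonneg z A)
    (mul_nonneg (div_nonneg (by positivity) (by linarith)) (div_nonneg hτ.le (by linarith)))
    (lintegral_attackTime_le hτ hq hq2 z A)

lemma integrable_snd_zero (hτ : 0 < τ₀) (hq : 0 < q) (hq1 : q < 1) :
    Integrable (fun ω : Path => ω.2 0) (law q τ₀) ∧ ∫ ω, ω.2 0 ∂law q τ₀ = τ₀ / q := by
  have hm : Measurable fun ω : Path => ω.2 0 := by fun_prop
  have h0 : ∀ᵐ ω ∂law q τ₀, 0 ≤ ω.2 0 := (ae_pos_law hτ hq hq1).mono fun ω h => (h 0).2.le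
  refine ⟨(integrable_of_lintegral_le hm h0 (by positivity)
    (lintegral_snd_zero hτ hq hq1).le).1, ?_⟩
  rw [integral_eq_lintegral_of_nonneg_ae h0 hm.aestronglyMeasurable, lintegral_snd_zero hτ hq hq1,
    ENNReal.toReal_ofReal (by positivity)]

lemma integrable_duration (hτ : 0 < τ₀) (hq : 0 < q) (hq2 : q < 1 / 2) (z A : ℕ) :
    Integrable (duration z A) (law q τ₀) ∧ τ₀ / q ≤ ∫ ω, duration z A ω ∂law q τ₀ ∧
      ∫ ω, duration z A ω ∂law q τ₀
        ≤ τ₀ / q + (A + 1) / (1 - 2 * q) * (τ₀ / (1 - q)) := by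
  have hq1 : q < 1 := by linarith
  have hp := measurePreserving_afterPreMine hτ hq hq1
  obtain ⟨i1, e1⟩ := integrable_snd_zero hτ hq hq1
  obtain ⟨i2, e2⟩ := integrable_attackTime hτ hq hq2 z A
  have i3 : Integrable (fun ω => attackTime z A (afterPreMine ω)) (law q τ₀) :=
    hp.integrable_comp_of_integrable i2
  have e3 : ∫ ω, attackTime z A (afterPreMine ω) ∂law q τ₀
      = ∫ η, attackTime z A η ∂law q τ₀ := by
    rw [← integral_map hp.measurable.aemeasurable
      (by rw [hp.map_eq]; exact i2.aestronglyMeasurable), hp.map_eq]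
  have e4 : 0 ≤ ∫ η, attackTime z A η ∂law q τ₀ :=
    integral_nonneg_of_ae ((ae_regular hτ hq hq1).mono fun η h => h.attackTime_nonneg z A)
  have hae := duration_ae_eq hτ hq hq2 z A
  refine ⟨(i1.add i3).congr hae.symm, ?_⟩
  rw [integral_congr_ae hae, integral_add i1 i3, e1, e3]
  exact ⟨by linarith, by linarith⟩

end Law

/-! ### Expected revenue -/

lemma measurable_reward (b v : ℝ) (z A : ℕ) : Measurable (reward b v z A) := by
  classical
  refine measurable_eval_nat (f := fun n η => if ListSucceeds z (bits n η) then
    v + b * (1 + attackCount n η : ℕ) else 0) (measurable_endIndex z A) fun n => ?_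
  exact measurable_comp_bits
    (fun l => if ListSucceeds z l then v + b * (1 + l.count true : ℕ) else 0) n

lemma reward_nonneg {b v : ℝ} (hb : 0 ≤ b) (hv : 0 ≤ v) (z A : ℕ) (η : Path) :
    0 ≤ reward b v z A η := by
  unfold reward
  split_ifs <;> positivity

lemma reward_le {b v : ℝ} (hb : 0 ≤ b) (hv : 0 ≤ v) (z A : ℕ) (η : Path) :
    reward b v z A η ≤ v + b * (1 + endIndex z A η) := by
  have h : attackCount (endIndex z A η) η ≤ endIndex z A η := by
    have := honestCount_add_attackCount (endIndex z A η) η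
    omega
  have h' : (attackCount (endIndex z A η) η : ℝ) ≤ endIndex z A η := by exact_mod_cast h
  unfold reward
  split_ifs
  · push_cast
    gcongr
  · positivity

/-- If the attacker finds `z` of the first `2 z` blocks, then the attack ends successfully with
these blocks. -/
lemma reward_of_attackCount_eq {z A : ℕ} (hA : z ≤ A) {η : Path}
    (h : attackCount (2 * z) η = z) (b v : ℝ) : reward b v z A η = v + b * (z + 1) := by
  have hsum := honestCount_add_attackCount (2 * z) η
  have hs : ListSucceeds z (bits (2 * z) η) := by
    unfold ListSucceeds
    unfold honestCount attackCount at *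
    omega
  have hend : endIndex z A η = 2 * z := by
    -- No earlier end is possible: success needs `2 * z` blocks, and giving up needs more than `A ≥
    -- z` honest ones, while only `z` occur.
    refine le_antisymm (Nat.sInf_le (Or.inl hs)) ?_
    by_contra hlt
    rw [not_le] at hlt
    have hE : Ended z A (bits (endIndex z A η) η) :=
      Nat.sInf_mem (s := {n | Ended z A (bits n η)}) ⟨_, Or.inl hs⟩
    obtain ⟨m, hm⟩ := Nat.exists_eq_add_of_le hlt.le
    have hk := honestCount_add_attackCount (endIndex z A η) η
    have happ := bits_add (endIndex z A η) m η
    rw [← hm] at happ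
    unfold honestCount attackCount at *
    rw [happ, List.count_append] at h hsum
    rw [List.count_append] at hsum
    simp only [Ended, ListSucceeds] at hE
    omega
  rw [reward, hend, if_pos hs, h]
  push_cast
  ring

/-- A successful attack takes at least `2 z` blocks, at least half of them found by the attacker. -/
lemma ListSucceeds.length_le {z n : ℕ} {η : Path} (h : ListSucceeds z (bits n η)) :
    2 * z ≤ n ∧ n ≤ 2 * attackCount n η ∧ (n = 2 * z → attackCount n η = z) := by
  have := honestCount_add_attackCount n η
  unfold ListSucceeds at h
  unfold honestCount attackCount at *
  omega

section Law

variable {q τ₀ : ℝ}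

lemma revenue_ae_eq (hτ : 0 < τ₀) (hq : 0 < q) (hq2 : q < 1 / 2) (z A : ℕ) (b v : ℝ) :
    revenue b v z A =ᵐ[law q τ₀] fun ω => reward b v z A (afterPreMine ω) := by
  have hq1 : q < 1 := by linarith
  filter_upwards [ae_regular hτ hq hq1, ae_exists_attack hτ hq hq1,
    ae_exists_ended_afterPreMine hτ hq hq2 z A] with ω h1 h2 h3
  exact h1.revenue_eq h2 h3 b v

lemma lintegral_endIndex_le (hτ : 0 < τ₀) (hq : 0 < q) (hq2 : q < 1 / 2) (z A : ℕ) :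
    ∫⁻ η, (endIndex z A η : ℝ≥0∞) ∂law q τ₀ ≤ ENNReal.ofReal ((A + 1) / (1 - 2 * q)) := by
  classical
  have hq1 : q < 1 := by linarith
  have := isProbabilityMeasure_law hτ hq hq1
  have h := lintegral_tsum_running hτ hq hq1 z A (g := fun _ => 1) measurable_const
  rw [lintegral_one, measure_univ, mul_one] at h
  calc _ = _ := lintegral_congr_ae ?_
    _ = _ := h
    _ ≤ _ := tsum_runProb_le hτ hq hq2 z A
  filter_upwards [ae_exists_ended hτ hq hq2 z A] with η h2
  simp only [running_bits_iff_lt h2]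
  rw [tsum_eq_sum (s := Finset.range (endIndex z A η)) fun n hn => by simp_all,
    Finset.sum_congr rfl fun i hi => if_pos (Finset.mem_range.1 hi)]
  simp

lemma integrable_reward (hτ : 0 < τ₀) (hq : 0 < q) (hq2 : q < 1 / 2) (z A : ℕ) {b v : ℝ}
    (hb : 0 ≤ b) (hv : 0 ≤ v) : Integrable (reward b v z A) (law q τ₀) := by
  have := isProbabilityMeasure_law hτ hq (by linarith)
  have hm : Measurable fun η => (endIndex z A η : ℝ) :=
    measurable_from_nat.comp (measurable_endIndex z A)
  have hN : Integrable (fun η => (endIndex z A η : ℝ)) (law q τ₀) := by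
    refine (integrable_of_lintegral_le hm (ae_of_all _ fun η => by positivity)
      (c := (A + 1) / (1 - 2 * q)) (div_nonneg (by positivity) (by linarith)) ?_).1
    simpa using lintegral_endIndex_le hτ hq hq2 z A
  refine ((integrable_const v).add (((integrable_const 1).add hN).const_mul b)).mono'
    (measurable_reward b v z A).aestronglyMeasurable (ae_of_all _ fun η => ?_)
  rw [Real.norm_of_nonneg (reward_nonneg hb hv z A η)]
  exact reward_le hb hv z A η

lemma integrable_revenue (hτ : 0 < τ₀) (hq : 0 < q) (hq2 : q < 1 / 2) (z A : ℕ) {b v : ℝ}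
    (hb : 0 ≤ b) (hv : 0 ≤ v) : Integrable (revenue b v z A) (law q τ₀) ∧
      ∫ ω, revenue b v z A ω ∂law q τ₀ = ∫ η, reward b v z A η ∂law q τ₀ := by
  have hp := measurePreserving_afterPreMine hτ hq (by linarith)
  have i2 := integrable_reward hτ hq hq2 z A hb hv
  have hae := revenue_ae_eq hτ hq hq2 z A b v
  refine ⟨(hp.integrable_comp_of_integrable i2).congr hae.symm, ?_⟩
  rw [integral_congr_ae hae]
  conv_rhs => rw [← hp.map_eq]
  rw [integral_map hp.measurable.aemeasurable (by rw [hp.map_eq]; exact i2.aestronglyMeasurable)]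

lemma lintegral_attackCount_eq (hτ : 0 < τ₀) (hq : 0 < q) (hq1 : q < 1) (n k : ℕ) :
    ∫⁻ η, (if attackCount n η = k then 1 else 0) ∂law q τ₀
      = ENNReal.ofReal (n.choose k * q ^ k * (1 - q) ^ (n - k)) := by
  rw [lintegral_bits hτ hq hq1 n (fun l => if l.count true = k then 1 else 0), expect_count_eq]
  simp only [prob, Bool.false_eq_true, if_false, if_true]
  rw [ENNReal.ofReal_mul (by positivity), ENNReal.ofReal_mul (by positivity),
    ENNReal.ofReal_pow hq.le, ENNReal.ofReal_pow (by linarith), ENNReal.ofReal_natCast]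

/-- Only the event that the attacker finds `z` of the first `2 * z` blocks is kept. -/
lemma le_integral_revenue (hτ : 0 < τ₀) (hq : 0 < q) (hq2 : q < 1 / 2) {z A : ℕ} (hA : z ≤ A)
    {b v : ℝ} (hb : 0 ≤ b) (hv : 0 ≤ v) :
    (2 * z).choose z * (v + b * (z + 1)) * (q ^ z * (1 - q) ^ z)
      ≤ ∫ ω, revenue b v z A ω ∂law q τ₀ := by
  have hq1 : q < 1 := by linarith
  have hp0 : (0 : ℝ) ≤ 1 - q := by linarith
  rw [(integrable_revenue hτ hq hq2 z A hb hv).2, integral_eq_lintegral_of_nonneg_ae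
    (ae_of_all _ (reward_nonneg hb hv z A)) (measurable_reward b v z A).aestronglyMeasurable]
  rw [← ENNReal.ofReal_le_iff_le_toReal
    ((integrable_reward hτ hq hq2 z A hb hv).lintegral_lt_top).ne]
  have hm : Measurable fun η => if attackCount (2 * z) η = z then (1 : ℝ≥0∞) else 0 :=
    measurable_comp_bits (fun l => if l.count true = z then 1 else 0) (2 * z)
  calc _ = ENNReal.ofReal (v + b * (z + 1))
        * ENNReal.ofReal ((2 * z).choose z * q ^ z * (1 - q) ^ (2 * z - z)) := by
        rw [← ENNReal.ofReal_mul (by positivity), show 2 * z - z = z by omega]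
        congr 1
        ring
    _ = ∫⁻ η, ENNReal.ofReal (v + b * (z + 1))
        * (if attackCount (2 * z) η = z then 1 else 0) ∂law q τ₀ := by
        rw [lintegral_const_mul _ hm, lintegral_attackCount_eq hτ hq hq1]
    _ ≤ _ := lintegral_mono fun η => by
        split_ifs with h
        · rw [mul_one, reward_of_attackCount_eq hA h]
        · simp

/-- The mean of `q⁻¹ ^ attackCount` is `(2 - q) ^ n ≤ 2 ^ n`. By `one_le_chernoff` the integrand
dominates the indicator that the attacker found at least half of the blocks. -/
lemma lintegral_chernoff_le (hτ : 0 < τ₀) (hq : 0 < q) (hq1 : q < 1) (n : ℕ) :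
    ∫⁻ η, ENNReal.ofReal (√q) ^ n * ENNReal.ofReal q⁻¹ ^ attackCount n η ∂law q τ₀
      ≤ ENNReal.ofReal ((2 * √q) ^ n) := by
  rw [lintegral_bits hτ hq hq1 n
    (fun l => ENNReal.ofReal (√q) ^ n * ENNReal.ofReal q⁻¹ ^ l.count true), expect_const_mul,
    expect_pow_count, ENNReal.ofReal_pow (by positivity), mul_comm 2, ← mul_pow]
  rw [ENNReal.ofReal_mul (by positivity)]
  gcongr
  simp only [prob, Bool.false_eq_true, if_false, if_true]
  rw [← ENNReal.ofReal_mul hq.le, ← ENNReal.ofReal_add (by linarith) (by positivity),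
    mul_inv_cancel₀ hq.ne']
  exact ENNReal.ofReal_le_ofReal (by linarith)

lemma one_le_chernoff (hq : 0 < q) (hq1 : q < 1) {n k : ℕ} (h : n ≤ 2 * k) :
    1 ≤ ENNReal.ofReal (√q) ^ n * ENNReal.ofReal q⁻¹ ^ k := by
  rw [← ENNReal.ofReal_pow (by positivity), ← ENNReal.ofReal_pow (by positivity),
    ← ENNReal.ofReal_mul (by positivity), ENNReal.one_le_ofReal]
  have h1 : √q ^ (2 * k) ≤ √q ^ n :=
    pow_le_pow_of_le_one (by positivity) (Real.sqrt_le_one.2 hq1.le) h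
  rw [pow_mul, Real.sq_sqrt hq.le] at h1
  calc (1 : ℝ) = q ^ k * q⁻¹ ^ k := by rw [← mul_pow, mul_inv_cancel₀ hq.ne', one_pow]
    _ ≤ _ := by gcongr

/-- A bound of the revenue by the revenue after `2 z` blocks and terms that are small in mean. -/
lemma ofReal_reward_le (hq : 0 < q) (hq1 : q < 1) {b v : ℝ} (hb : 0 ≤ b) (hv : 0 ≤ v) (z A : ℕ)
    (η : Path) :
    ENNReal.ofReal (reward b v z A η) ≤ ENNReal.ofReal (v + b * (z + 1))
        * (if attackCount (2 * z) η = z then 1 else 0)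
      + ∑' m : ℕ, ENNReal.ofReal (v + b * (2 * z + 2 + m))
        * (ENNReal.ofReal (√q) ^ (2 * z + 1 + m)
          * ENNReal.ofReal q⁻¹ ^ attackCount (2 * z + 1 + m) η) := by
  by_cases hs : ListSucceeds z (bits (endIndex z A η) η)
  · obtain ⟨h1, h2, h3⟩ := hs.length_le
    -- A successful attack of length `2 * z` is covered by the first term, one of length `2 * z + 1
    -- + m` by the `m`-th term of the series.
    rcases h1.eq_or_lt with h | h
    · have h4 := h3 h.symm
      rw [reward, if_pos hs, h4]
      rw [← h] at h4
      rw [if_pos h4, mul_one]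
      refine le_trans (le_of_eq ?_) le_self_add
      push_cast
      ring_nf
    · obtain ⟨m, hm⟩ := Nat.exists_eq_add_of_le (show 2 * z + 1 ≤ _ from h)
      refine le_trans ?_ (le_trans (ENNReal.le_tsum m) le_add_self)
      rw [← hm]
      refine le_trans (ENNReal.ofReal_le_ofReal (reward_le hb hv z A η)) ?_
      refine le_trans (le_of_eq ?_) (le_mul_of_one_le_right' (one_le_chernoff hq hq1 h2))
      rw [hm]
      push_cast
      ring_nf
  · rw [reward, if_neg hs]
    simp

lemma hasSum_tail (b v c : ℝ) :
    HasSum (fun m : ℕ => (v + b * (c + m)) * (1 / 2) ^ m) (2 * v + b * (2 * c + 2)) := by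
  have h1 := (hasSum_geometric_two).mul_left (v + b * c)
  have h2 := (hasSum_coe_mul_geometric_of_norm_lt_one (𝕜 := ℝ) (r := 1 / 2)
    (by norm_num)).mul_left b
  convert! h1.add h2 using 1
  · ext m; ring
  · norm_num; ring

lemma integral_revenue_le (hτ : 0 < τ₀) (hq : 0 < q) (hq16 : q ≤ 1 / 16) (z A : ℕ)
    {b v : ℝ} (hb : 0 ≤ b) (hv : 0 ≤ v) :
    ∫ ω, revenue b v z A ω ∂law q τ₀ ≤ q ^ z * ((2 * z).choose z * (v + b * (z + 1))
      + 2 ^ (2 * z + 1) * (2 * v + b * (4 * z + 6)) * √q) := by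
  have hq1 : q < 1 := by linarith
  have hq2 : q < 1 / 2 := by linarith
  -- This is the use of `q ≤ 1 / 16`: the tail has ratio `2 * √q ≤ 1 / 2`.
  have hsq : √q ≤ 1 / 4 := by
    rw [Real.sqrt_le_left (by norm_num)]
    linarith
  rw [(integrable_revenue hτ hq hq2 z A hb hv).2]
  refine (integrable_of_lintegral_le (measurable_reward b v z A)
    (ae_of_all _ (reward_nonneg hb hv z A)) (by positivity) ?_).2
  have hm : Measurable fun η => if attackCount (2 * z) η = z then (1 : ℝ≥0∞) else 0 :=
    measurable_comp_bits (fun l => if l.count true = z then 1 else 0) (2 * z)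
  have hm' : ∀ m : ℕ, Measurable fun η => ENNReal.ofReal (√q) ^ (2 * z + 1 + m)
          * ENNReal.ofReal q⁻¹ ^ attackCount (2 * z + 1 + m) η := fun m =>
    measurable_comp_bits (fun l => ENNReal.ofReal (√q) ^ (2 * z + 1 + m)
          * ENNReal.ofReal q⁻¹ ^ l.count true) _
  have hterm : ∀ m : ℕ, ENNReal.ofReal (v + b * (2 * z + 2 + m))
        * ∫⁻ η, (ENNReal.ofReal (√q) ^ (2 * z + 1 + m)
          * ENNReal.ofReal q⁻¹ ^ attackCount (2 * z + 1 + m) η) ∂law q τ₀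
      ≤ ENNReal.ofReal (2 ^ (2 * z + 1) * (q ^ z * √q)
        * ((v + b * ((2 * z + 2 : ℝ) + m)) * (1 / 2) ^ m)) := by
    intro m
    refine le_trans (mul_le_mul_right (lintegral_chernoff_le hτ hq hq1 _) _) ?_
    rw [← ENNReal.ofReal_mul (by positivity)]
    refine ENNReal.ofReal_le_ofReal ?_
    -- The odd exponent `2 * z + 1` yields `q ^ z * √q`, hence the gain of `√q` over the main term.
    have e : (2 * √q) ^ (2 * z + 1 + m)
        = 2 ^ (2 * z + 1) * (q ^ z * √q) * (2 * √q) ^ m := by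
      rw [pow_add, mul_pow, pow_succ (√q), pow_mul (√q), Real.sq_sqrt hq.le]
    have h2 : (2 * √q) ^ m ≤ (1 / 2) ^ m := by
      gcongr
      linarith
    rw [e, mul_left_comm]
    gcongr
  have hs := (hasSum_tail b v (2 * z + 2)).mul_left (2 ^ (2 * z + 1) * (q ^ z * √q))
  calc _ ≤ ∫⁻ η, _ ∂law q τ₀ := lintegral_mono fun η => ofReal_reward_le hq hq1 hb hv z A η
    _ = ENNReal.ofReal (v + b * (z + 1))
          * ENNReal.ofReal ((2 * z).choose z * q ^ z * (1 - q) ^ (2 * z - z))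
        + ∑' m : ℕ, ENNReal.ofReal (v + b * (2 * z + 2 + m))
        * ∫⁻ η, (ENNReal.ofReal (√q) ^ (2 * z + 1 + m)
          * ENNReal.ofReal q⁻¹ ^ attackCount (2 * z + 1 + m) η) ∂law q τ₀ := by
        rw [lintegral_add_left (hm.const_mul _), lintegral_const_mul _ hm,
          lintegral_attackCount_eq hτ hq hq1,
          lintegral_tsum fun m => ((hm' m).const_mul _).aemeasurable]
        congr 1
        exact tsum_congr fun m => lintegral_const_mul _ (hm' m)
    _ ≤ ENNReal.ofReal (v + b * (z + 1)) * ENNReal.ofReal ((2 * z).choose z * q ^ z)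
        + ∑' m : ℕ, ENNReal.ofReal (2 ^ (2 * z + 1) * (q ^ z * √q)
          * ((v + b * ((2 * z + 2 : ℝ) + m)) * (1 / 2) ^ m)) := by
        refine add_le_add (mul_le_mul' le_rfl (ENNReal.ofReal_le_ofReal ?_))
          (ENNReal.tsum_le_tsum hterm)
        exact mul_le_of_le_one_right (by positivity) (pow_le_one₀ (by linarith) (by linarith))
    _ = _ := by
        rw [← ENNReal.ofReal_tsum_of_nonneg (fun m => by positivity) hs.summable, hs.tsum_eq,
          ← ENNReal.ofReal_mul (by positivity), ← ENNReal.ofReal_add (by positivity)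
            (by positivity)]
        congr 1
        ring

end Law

/-! ### Leading term, threshold and bounds of the revenue ratio -/

lemma choose_two_mul {z : ℕ} (hz : 1 ≤ z) : (2 * z).choose z = 2 * (2 * z - 1).choose z := by
  obtain ⟨m, rfl⟩ := Nat.exists_eq_add_of_le' hz
  rw [show 2 * (m + 1) = (2 * m + 1) + 1 by ring, Nat.choose_succ_succ, Nat.add_sub_cancel,
    Nat.choose_symm_half]
  ring

lemma one_div_beta {z : ℕ} (hz : 1 ≤ z) : 1 / beta z z = z * ((2 * z - 1).choose z : ℝ) := by
  obtain ⟨m, rfl⟩ := Nat.exists_eq_add_of_le' hz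
  have h1 : ((m + 1 : ℕ) : ℝ) + ((m + 1 : ℕ) : ℝ) = ((2 * m + 1 : ℕ) : ℝ) + 1 := by
    push_cast; ring
  rw [beta, h1, Real.Gamma_nat_eq_factorial]
  rw [show ((m + 1 : ℕ) : ℝ) = (m : ℝ) + 1 by push_cast; ring, Real.Gamma_nat_eq_factorial,
    show 2 * (m + 1) - 1 = 2 * m + 1 by omega,
    Nat.cast_choose ℝ (show m + 1 ≤ 2 * m + 1 by omega),
    show 2 * m + 1 - (m + 1) = m by omega, Nat.factorial_succ m]
  have := Nat.factorial_ne_zero m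
  push_cast
  field_simp

lemma leadingTerm_eq {τ₀ b v q : ℝ} {z : ℕ} (hb : b ≠ 0) (hz : 1 ≤ z) :
    leadingTerm τ₀ b v z q
      = (2 * z).choose z * (v + b * (z + 1)) * q ^ z * (q / τ₀) := by
  rw [leadingTerm, choose_two_mul hz, show (2 : ℝ) / beta z z = 2 * (1 / beta z z) by ring,
    one_div_beta hz]
  push_cast
  field_simp
  ring

lemma threshold_eq {b q : ℝ} {z : ℕ} (hz : 1 ≤ z) :
    threshold b z q = b / ((2 * z).choose z * q ^ z) := by
  rw [threshold, choose_two_mul hz]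
  push_cast
  rw [div_mul_eq_mul_div, inv_mul_eq_div, div_div, mul_comm (q ^ z)]

lemma one_le_choose (z : ℕ) : (1 : ℝ) ≤ (2 * z).choose z := by
  exact_mod_cast Nat.choose_pos (by omega)

/-- Neither the duration nor success depends on `v` or `b`, so the revenue is linear in them. -/
lemma revenue_eq_add (b v : ℝ) (z A : ℕ) (ω : Path) :
    revenue b v z A ω = v * revenue 0 1 z A ω + b * revenue 1 0 z A ω := by
  unfold revenue
  split_ifs <;> ring

section Law

variable {q τ₀ b v : ℝ} {z A : ℕ}

lemma integral_duration_pos (hτ : 0 < τ₀) (hq : 0 < q) (hq2 : q < 1 / 2) (z A : ℕ) :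
    0 < ∫ ω, duration z A ω ∂law q τ₀ :=
  (div_pos hτ hq).trans_le (integrable_duration hτ hq hq2 z A).2.1

lemma integral_revenue_eq_add (hτ : 0 < τ₀) (hq : 0 < q) (hq2 : q < 1 / 2) (b v : ℝ) (z A : ℕ) :
    ∫ ω, revenue b v z A ω ∂law q τ₀ = v * ∫ ω, revenue 0 1 z A ω ∂law q τ₀
      + b * ∫ ω, revenue 1 0 z A ω ∂law q τ₀ := by
  have i1 := (integrable_revenue hτ hq hq2 z A le_rfl zero_le_one).1
  have i2 := (integrable_revenue hτ hq hq2 z A zero_le_one le_rfl).1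
  simp_rw [revenue_eq_add b v]
  rw [integral_add (i1.const_mul v) (i2.const_mul b), integral_const_mul, integral_const_mul]

/-- The mean revenue is affine in `v`, with slope the positive probability `P` of success, so the
profitable amounts form a closed half-line. -/
lemma isLeast_minimalAmount (hτ : 0 < τ₀) (hq : 0 < q) (hq2 : q < 1 / 2) (hA : z ≤ A) :
    IsLeast (profitableAmounts τ₀ b z A q) (minimalAmount τ₀ b z A q) := by
  have hD := integral_duration_pos hτ hq hq2 z A
  have hP : 0 < ∫ ω, revenue 0 1 z A ω ∂law q τ₀ := by
    refine lt_of_lt_of_le ?_ (le_integral_revenue hτ hq hq2 hA le_rfl zero_le_one)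
    have := one_le_choose z
    have : 0 < 1 - q := by linarith
    positivity
  set D := ∫ ω, duration z A ω ∂law q τ₀ with hDdef
  set P := ∫ ω, revenue 0 1 z A ω ∂law q τ₀ with hPdef
  set Q := ∫ ω, revenue 1 0 z A ω ∂law q τ₀ with hQdef
  have h : profitableAmounts τ₀ b z A q
      = Set.Ici (max 0 ((honestRatio τ₀ b q * D - b * Q) / P)) := by
    ext v
    simp only [profitableAmounts, Set.mem_ofPred_eq, Set.mem_Ici, max_le_iff, revenueRatio]
    rw [integral_revenue_eq_add hτ hq hq2 b v, ← hDdef, ← hPdef, ← hQdef, le_div_iff₀ hD,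
      div_le_iff₀ hP, sub_le_iff_le_add]
  rw [minimalAmount, h, csInf_Ici]
  exact isLeast_Ici

lemma revenueRatio_le (hτ : 0 < τ₀) (hb : 0 < b) (hz : 1 ≤ z) (hq : 0 < q) (hq16 : q ≤ 1 / 16)
    (hv : 0 ≤ v) (A : ℕ) :
    revenueRatio τ₀ b v z A q ≤ (1 + 6 * 2 ^ (2 * z + 1) * √q) * leadingTerm τ₀ b v z q := by
  have hq2 : q < 1 / 2 := by linarith
  have hR := integral_revenue_le hτ hq hq16 z A hb.le hv
  have hC := one_le_choose z
  rw [leadingTerm_eq hb.ne' hz, revenueRatio]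
  -- Bounding the tail by a multiple of the main term makes the relative error independent of `v`.
  have h1 : (2 * v + b * (4 * z + 6)) ≤ 6 * ((2 * z).choose z * (v + b * (z + 1))) := by
    have : v + b * (z + 1) ≤ (2 * z).choose z * (v + b * (z + 1)) :=
      le_mul_of_one_le_left (by positivity) hC
    nlinarith [mul_nonneg hb.le (Nat.cast_nonneg (α := ℝ) z)]
  calc _ ≤ (q ^ z * ((2 * z).choose z * (v + b * (z + 1))
      + 2 ^ (2 * z + 1) * (6 * ((2 * z).choose z * (v + b * (z + 1)))) * √q)) / (τ₀ / q) := by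
        refine div_le_div₀ (by positivity) (hR.trans ?_) (by positivity)
          (integrable_duration hτ hq hq2 z A).2.1
        gcongr
    _ = _ := by
        field_simp

lemma le_revenueRatio (hτ : 0 < τ₀) (hb : 0 < b) (hz : 1 ≤ z) (hq : 0 < q) (hq16 : q ≤ 1 / 16)
    (hv : 0 ≤ v) (hA : max 2 z ≤ A) :
    (1 - z * q) * leadingTerm τ₀ b v z q ≤ (1 + 3 * (q * A)) * revenueRatio τ₀ b v z A q := by
  have hq2 : q < 1 / 2 := by linarith
  have hR := le_integral_revenue hτ hq hq2 ((le_max_right 2 z).trans hA) hb.le hv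
  obtain ⟨-, hD0, hD⟩ := integrable_duration hτ hq hq2 z A
  have hDpos := integral_duration_pos hτ hq hq2 z A
  have hA2 : (2 : ℝ) ≤ A := by exact_mod_cast (le_max_left 2 z).trans hA
  have hC := one_le_choose z
  have hbern : 1 - z * q ≤ (1 - q) ^ z := by
    have := one_add_mul_le_pow (a := -q) (by linarith) z
    calc _ = 1 + (z : ℝ) * -q := by ring
      _ ≤ _ := this
      _ = _ := by ring
  have hD' : ∫ ω, duration z A ω ∂law q τ₀ ≤ τ₀ / q * (1 + 3 * (q * A)) := by
    refine hD.trans ?_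
    -- The denominators multiply to at least `1 / 2`, and `2 * (A + 1) ≤ 3 * A + 1 * 0` is
    -- equivalent to `A ≥ 2`.
    have h1 : (A + 1) / (1 - 2 * q) * (τ₀ / (1 - q)) ≤ (3 * A) * τ₀ := by
      rw [div_mul_div_comm, div_le_iff₀ (mul_pos (by linarith) (by linarith))]
      have h2 : (1 : ℝ) / 2 ≤ (1 - 2 * q) * (1 - q) := by nlinarith
      have h3 : 3 * A * τ₀ * (1 / 2) ≤ 3 * A * τ₀ * ((1 - 2 * q) * (1 - q)) := by gcongr
      nlinarith
    have h4 : τ₀ / q * (1 + 3 * (q * A)) = τ₀ / q + 3 * A * τ₀ := by field_simp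
    linarith
  have hR0 : 0 ≤ ∫ ω, revenue b v z A ω ∂law q τ₀ :=
    le_trans (mul_nonneg (by positivity) (mul_nonneg (by positivity)
      (pow_nonneg (by linarith) _))) hR
  rw [leadingTerm_eq hb.ne' hz, revenueRatio]
  calc _ = (2 * z).choose z * (v + b * (z + 1)) * (q ^ z * (1 - z * q)) * (q / τ₀) := by ring
    _ ≤ (2 * z).choose z * (v + b * (z + 1)) * (q ^ z * (1 - q) ^ z) * (q / τ₀) := by gcongr
    _ ≤ (∫ ω, revenue b v z A ω ∂law q τ₀) * (q / τ₀) := by gcongr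
    _ ≤ _ := by
        rw [← mul_div_assoc (1 + 3 * (q * (A : ℝ))), le_div_iff₀ hDpos, mul_assoc, mul_comm (1 + 3 * (q * A))]
        gcongr
        calc _ ≤ q / τ₀ * (τ₀ / q * (1 + 3 * (q * A))) := by gcongr
          _ = _ := by field_simp

lemma leadingTerm_pos (hτ : 0 < τ₀) (hb : 0 < b) (hz : 1 ≤ z) (hq : 0 < q) (hv : 0 ≤ v) :
    0 < leadingTerm τ₀ b v z q := by
  have := one_le_choose z
  rw [leadingTerm_eq hb.ne' hz]
  positivity

lemma threshold_pos (hb : 0 < b) (hz : 1 ≤ z) (hq : 0 < q) : 0 < threshold b z q := by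
  have := one_le_choose z
  rw [threshold_eq hz]
  positivity

end Law

/-! ### Uniform asymptotics -/

lemma exists_small {ε K L : ℝ} (hε : 0 < ε) (hK : 0 < K) (hL : 0 < L) :
    ∃ δ : ℝ, 0 < δ ∧ δ ≤ 1 / 16 ∧ K * √δ ≤ ε ∧ L * δ ≤ ε := by
  refine ⟨min (1 / 16) (min ((ε / K) ^ 2) (ε / L)), by positivity, min_le_left _ _, ?_, ?_⟩
  · rw [← le_div_iff₀' hK]
    exact Real.sqrt_le_iff.2 ⟨by positivity, (min_le_right _ _).trans (min_le_left _ _)⟩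
  · rw [← le_div_iff₀' hL]
    exact (min_le_right _ _).trans (min_le_right _ _)

section Uniform

variable {τ₀ b : ℝ} {z : ℕ}

lemma revenueRatio_uniform (hτ : 0 < τ₀) (hb : 0 < b) (hz : 1 ≤ z) {v : ℝ} (hv : 0 ≤ v) {ε : ℝ}
    (hε : 0 < ε) : ∃ δ : ℝ, 0 < δ ∧ δ < 1 / 2 ∧
      ∀ q : ℝ, 0 < q → q ≤ δ → ∀ A : ℕ, max 2 z ≤ A →
        revenueRatio τ₀ b v z A q ≤ (1 + ε) * leadingTerm τ₀ b v z q ∧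
        (q * A ≤ δ →
          (1 - ε) * leadingTerm τ₀ b v z q ≤ revenueRatio τ₀ b v z A q) := by
  -- `K` is the constant of `revenueRatio_le`; `L` collects the losses `z * q` and `3 * (q * A)` of
  -- `le_revenueRatio`.
  obtain ⟨δ, hδ, hδ16, h1, h2⟩ := exists_small hε (K := 6 * 2 ^ (2 * z + 1)) (L := z + 3)
    (by positivity) (by positivity)
  refine ⟨δ, hδ, by linarith, fun q hq hqδ A hA => ?_⟩
  have hL := leadingTerm_pos hτ hb hz hq hv
  refine ⟨(revenueRatio_le hτ hb hz hq (hqδ.trans hδ16) hv A).trans ?_, fun hqA => ?_⟩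
  · have h3 : 6 * 2 ^ (2 * z + 1) * √q ≤ 6 * 2 ^ (2 * z + 1) * √δ := by gcongr
    gcongr
    exact h3.trans h1
  · have h3 := le_revenueRatio hτ hb hz hq (hqδ.trans hδ16) hv hA
    have hqA0 : 0 ≤ q * A := by positivity
    refine le_of_mul_le_mul_left (le_trans ?_ h3) (show 0 < 1 + 3 * (q * A) by positivity)
    rw [← mul_assoc]
    gcongr
    have : (z : ℝ) * q ≤ z * δ := by gcongr
    nlinarith [mul_nonneg hε.le hqA0]

lemma profitable_uniform (hτ : 0 < τ₀) (hb : 0 < b) (hz : 1 ≤ z) {ε : ℝ} (hε : 0 < ε) :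
    ∃ δ : ℝ, 0 < δ ∧ δ < 1 / 2 ∧
      ∀ q : ℝ, 0 < q → q ≤ δ → ∀ A : ℕ, max 2 z ≤ A → ∀ v : ℝ, 0 ≤ v →
        (honestRatio τ₀ b q ≤ revenueRatio τ₀ b v z A q → (1 - ε) * threshold b z q ≤ v) ∧
        (q * A ≤ δ → (1 + ε) * threshold b z q ≤ v →
          honestRatio τ₀ b q < revenueRatio τ₀ b v z A q) := by
  have hC := one_le_choose z
  -- The second summand of `K` absorbs `b * (z + 1)`, which is `(z + 1) * C * q ^ z` times the
  -- threshold, using `q ^ z ≤ √q`. `L` is what `1 + 3 * (q * A) ≤ (1 - z * q) * (1 + ε)` requires.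
  obtain ⟨δ, hδ, hδ16, h1, h2⟩ := exists_small hε
    (K := 6 * 2 ^ (2 * z + 1) + (z + 1) * (2 * z).choose z) (L := z * (1 + ε) + 3)
    (by positivity) (by positivity)
  refine ⟨δ, hδ, by linarith, fun q hq hqδ A hA v hv => ?_⟩
  have hL := leadingTerm_pos hτ hb hz hq hv
  have hqz : 0 < q ^ z := by positivity
  set C : ℝ := ((2 * z).choose z : ℝ) with hCdef
  have hthr : C * q ^ z * threshold b z q = b := by
    rw [threshold_eq hz, ← hCdef]
    field_simp
  have hT := threshold_pos hb hz hq
  set T := threshold b z q with hTdef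
  have hhon : honestRatio τ₀ b q = b * (q / τ₀) := by rw [honestRatio]; ring
  have hqτ : 0 < q / τ₀ := by positivity
  refine ⟨fun h => ?_, fun hqA h => ?_⟩
  · have h3 := h.trans (revenueRatio_le hτ hb hz hq (hqδ.trans hδ16) hv A)
    rw [hhon, leadingTerm_eq hb.ne' hz, ← mul_assoc] at h3
    have h4 := le_of_mul_le_mul_right h3 hqτ
    set K : ℝ := 6 * 2 ^ (2 * z + 1) with hK
    have hK0 : 0 < K := by positivity
    have hs : √q ≤ √δ := Real.sqrt_le_sqrt hqδ
    have hqs : q ^ z ≤ √q := by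
      calc q ^ z ≤ q ^ 1 := pow_le_pow_of_le_one hq.le (by linarith) hz
        _ = √q * √q := by rw [pow_one, Real.mul_self_sqrt hq.le]
        _ ≤ √q * 1 := by
          gcongr
          exact Real.sqrt_le_one.2 (by linarith)
        _ = √q := mul_one _
    have h5 : (K + (z + 1) * C) * √q ≤ ε :=
      (mul_le_mul_of_nonneg_left hs (by positivity)).trans h1
    have h6 : T ≤ (1 + K * √q) * (v + b * (z + 1)) := by
      refine le_of_mul_le_mul_left ?_ (show 0 < C * q ^ z by positivity)
      rw [hthr]
      linarith
    have hKs : 0 ≤ K * √q := by positivity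
    -- This follows from `(1 - x) * (1 + x) ≤ 1` with `x = K * √q`; for `x ≥ 1` the left side is not
    -- positive.
    have h7 : (1 - K * √q) * T ≤ v + b * (z + 1) := by
      by_cases hneg : 1 - K * √q ≤ 0
      · have : (1 - K * √q) * T ≤ 0 := mul_nonpos_of_nonpos_of_nonneg hneg hT.le
        have : 0 ≤ v + b * (z + 1) := by positivity
        linarith
      · have h8 := mul_le_mul_of_nonneg_left h6 (not_le.1 hneg).le
        have h9 : 0 ≤ (K * √q) ^ 2 * (v + b * (z + 1)) := by positivity
        nlinarith
    have h10 : b * (z + 1) ≤ (z + 1) * C * √q * T := by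
      calc b * (z + 1) = (z + 1) * C * q ^ z * T := by rw [← hthr]; ring
        _ ≤ _ := by gcongr
    have h11 : (K + (z + 1) * C) * √q * T ≤ ε * T := by gcongr
    linarith
  · have h3 := le_revenueRatio hτ hb hz hq (hqδ.trans hδ16) hv hA
    have hqA0 : 0 ≤ q * A := by positivity
    have hzq : z * q ≤ z * δ := by gcongr
    have hzδ : 0 ≤ z * δ := by positivity
    have hzq1 : 0 < 1 - z * q := by
      by_contra hcon
      have : 1 ≤ z * δ := by linarith
      nlinarith
    -- Strictness comes from the block rewards `b * (z + 1) > 0`.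
    have hlead : (1 + ε) * honestRatio τ₀ b q < leadingTerm τ₀ b v z q := by
      rw [hhon, leadingTerm_eq hb.ne' hz, ← mul_assoc, ← hCdef]
      refine mul_lt_mul_of_pos_right ?_ hqτ
      have h4 : C * q ^ z * ((1 + ε) * T) ≤ C * q ^ z * v := by gcongr
      have h5 : 0 < C * q ^ z * (b * (z + 1)) := by positivity
      have h6 : C * q ^ z * ((1 + ε) * T) = (1 + ε) * b := by rw [← hthr]; ring
      rw [h6] at h4
      linarith
    have hh : 0 < honestRatio τ₀ b q := by rw [hhon]; positivity
    refine lt_of_mul_lt_mul_left (lt_of_le_of_lt ?_ (lt_of_lt_of_le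
      (mul_lt_mul_of_pos_left hlead hzq1) h3)) (show 0 ≤ 1 + 3 * (q * A) by positivity)
    rw [← mul_assoc (1 - z * q)]
    refine mul_le_mul_of_nonneg_right ?_ hh.le
    nlinarith

lemma isEquivalent_of_uniform {f g : ℝ → ℝ} (hg : ∀ q, 0 < q → 0 < g q) (A : ℕ)
    (h : ∀ ε : ℝ, 0 < ε → ∃ δ : ℝ, 0 < δ ∧ ∀ q, 0 < q → q ≤ δ → q * A ≤ δ →
      (1 - ε) * g q ≤ f q ∧ f q ≤ (1 + ε) * g q) : f ~[𝓝[>] 0] g := by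
  refine isLittleO_iff.2 fun ε hε => ?_
  obtain ⟨δ, hδ, h⟩ := h ε hε
  -- For fixed `A`, the bound `q ≤ δ / (A + 1)` ensures both `q ≤ δ` and `q * A ≤ δ`.
  have hδ' : 0 < δ / (A + 1) := by positivity
  filter_upwards [Ioc_mem_nhdsGT hδ'] with q hq
  have h1 : q * (A + 1) ≤ δ := (le_div_iff₀ (by positivity)).1 hq.2
  have h2 : 0 ≤ q * A := mul_nonneg hq.1.le (by positivity)
  obtain ⟨h3, h4⟩ := h q hq.1 (by linarith) (by linarith [hq.1])
  rw [Real.norm_of_nonneg (hg q hq.1).le, Pi.sub_apply, Real.norm_eq_abs, abs_le]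
  exact ⟨by linarith, by linarith⟩

lemma isEquivalent_revenueRatio (hτ : 0 < τ₀) (hb : 0 < b) (hz : 1 ≤ z) {v : ℝ} (hv : 0 ≤ v)
    {A : ℕ} (hA : max 2 z ≤ A) :
    revenueRatio τ₀ b v z A ~[𝓝[>] 0] leadingTerm τ₀ b v z := by
  refine isEquivalent_of_uniform (fun q hq => leadingTerm_pos hτ hb hz hq hv) A fun ε hε => ?_
  obtain ⟨δ, hδ, -, h⟩ := revenueRatio_uniform hτ hb hz hv hε
  exact ⟨δ, hδ, fun q hq hqδ hqA => ⟨(h q hq hqδ A hA).2 hqA, (h q hq hqδ A hA).1⟩⟩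

lemma isEquivalent_minimalAmount (hτ : 0 < τ₀) (hb : 0 < b) (hz : 1 ≤ z)
    {A : ℕ} (hA : max 2 z ≤ A) :
    minimalAmount τ₀ b z A ~[𝓝[>] 0] threshold b z := by
  refine isEquivalent_of_uniform (fun q hq => threshold_pos hb hz hq) A fun ε hε => ?_
  obtain ⟨δ, hδ, hδ2, h⟩ := profitable_uniform hτ hb hz hε
  refine ⟨δ, hδ, fun q hq hqδ hqA => ?_⟩
  have hl := isLeast_minimalAmount (b := b) hτ hq (by linarith) ((le_max_right 2 z).trans hA)
  have h0 : 0 ≤ (1 + ε) * threshold b z q :=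
    mul_nonneg (by linarith) (threshold_pos hb hz hq).le
  -- The minimum is itself profitable, which bounds it below; `(1 + ε)` times the threshold is
  -- profitable, which bounds it above.
  exact ⟨(h q hq hqδ A hA _ hl.1.1).1 hl.1.2,
    hl.2 ⟨h0, ((h q hq hqδ A hA _ h0).2 hqA le_rfl).le⟩⟩

end Uniform

end DoubleSpend

end

theorem mainTheorem3 (τ₀ b : ℝ) (hτ₀ : 0 < τ₀) (hb : 0 < b) (z : ℕ) (hz : 1 ≤ z) :
    -- the attack cycle ends almost surely and is integrable, and a minimal profitable amount exists
    (∀ q : ℝ, 0 < q → q < 1 / 2 → ∀ A : ℕ, max 2 z ≤ A →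
      (∀ᵐ ω ∂(DoubleSpend.law q τ₀), (DoubleSpend.endTimes z A ω).Nonempty) ∧
      Integrable (DoubleSpend.duration z A) (DoubleSpend.law q τ₀) ∧
      0 < ∫ ω, DoubleSpend.duration z A ω ∂(DoubleSpend.law q τ₀) ∧
      (∀ v : ℝ, 0 ≤ v → Integrable (DoubleSpend.revenue b v z A) (DoubleSpend.law q τ₀)) ∧
      IsLeast (DoubleSpend.profitableAmounts τ₀ b z A q) (DoubleSpend.minimalAmount τ₀ b z A q)) ∧
    -- asymptotics of the revenue ratio, the same for every `A`
    (∀ v : ℝ, 0 ≤ v → ∀ A : ℕ, max 2 z ≤ A →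
      DoubleSpend.revenueRatio τ₀ b v z A ~[𝓝[>] 0] DoubleSpend.leadingTerm τ₀ b v z) ∧
    -- uniformity in `A`: upper bound for all `A`, lower bound as long as `q * A` is small
    (∀ v : ℝ, 0 ≤ v → ∀ ε : ℝ, 0 < ε → ∃ δ : ℝ, 0 < δ ∧ δ < 1 / 2 ∧
      ∀ q : ℝ, 0 < q → q ≤ δ → ∀ A : ℕ, max 2 z ≤ A →
        DoubleSpend.revenueRatio τ₀ b v z A q ≤ (1 + ε) * DoubleSpend.leadingTerm τ₀ b v z q ∧
        (q * A ≤ δ →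
          (1 - ε) * DoubleSpend.leadingTerm τ₀ b v z q ≤
            DoubleSpend.revenueRatio τ₀ b v z A q)) ∧
    -- the minimal profitable amount is asymptotic to `v₀`
    (∀ A : ℕ, max 2 z ≤ A →
      DoubleSpend.minimalAmount τ₀ b z A ~[𝓝[>] 0] DoubleSpend.threshold b z) ∧
    -- uniformly in `A`, amounts below `(1 - ε) v₀` are not profitable, and amounts above
    -- `(1 + ε) v₀` are strictly profitable as long as `q * A` is small
    (∀ ε : ℝ, 0 < ε → ∃ δ : ℝ, 0 < δ ∧ δ < 1 / 2 ∧
      ∀ q : ℝ, 0 < q → q ≤ δ → ∀ A : ℕ, max 2 z ≤ A → ∀ v : ℝ, 0 ≤ v →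
        (DoubleSpend.honestRatio τ₀ b q ≤ DoubleSpend.revenueRatio τ₀ b v z A q →
          (1 - ε) * DoubleSpend.threshold b z q ≤ v) ∧
        (q * A ≤ δ → (1 + ε) * DoubleSpend.threshold b z q ≤ v →
          DoubleSpend.honestRatio τ₀ b q < DoubleSpend.revenueRatio τ₀ b v z A q)) := by
  refine ⟨fun q hq hq2 A hA => ⟨?_, ?_, ?_, fun v hv => ?_, ?_⟩, fun v hv A hA => ?_,
    fun v hv ε hε => ?_, fun A hA => ?_, fun ε hε => ?_⟩
  · exact DoubleSpend.ae_nonempty_endTimes hτ₀ hq hq2 z A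
  · exact (DoubleSpend.integrable_duration hτ₀ hq hq2 z A).1
  · exact DoubleSpend.integral_duration_pos hτ₀ hq hq2 z A
  · exact (DoubleSpend.integrable_revenue hτ₀ hq hq2 z A hb.le hv).1
  · exact DoubleSpend.isLeast_minimalAmount hτ₀ hq hq2 ((le_max_right 2 z).trans hA)
  · exact DoubleSpend.isEquivalent_revenueRatio hτ₀ hb hz hv hA
  · exact DoubleSpend.revenueRatio_uniform hτ₀ hb hz hv hε
  · exact DoubleSpend.isEquivalent_minimalAmount hτ₀ hb hz hA
  · exact DoubleSpend.profitable_uniform hτ₀ hb hz hε
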